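/- **Theorem 3 (asymptotic null distribution of the Rao-type test).** *Model.* Consider a step-stress life test with stress levels $x_1<\dots<x_k$, stress-change times $0<\tau_1<\dots<\tau_{k-1}$, termination time $\tau_k>\tau_{k-1}$ and inspection times $0=t_0<t_1<\dots<t_L=\tau_k$ that include all the $\tau_i$. The parameter is $\theta=(a_0,a_1,\eta)^T\in\Theta=\mathbb R\times(-\infty,0)\times(0,\infty)$. Put $\lambda_i=\exp(a_0+a_1x_i)$, let $h_0=0$ and let $h_i$ be determined by $(\tau_i+h_i)/\lambda_{i+1}=(\tau_i+h_{i-1})/\lambda_i$ (cumulative exposure). Under the Weibull cumulative exposure model the lifetime has distribution function $$F_T(t)=1-\exp\Big(-\Big(\frac{t+h_{i-1}}{\lambda_i}\Big)^{\eta}\Big),\qquad \tau_{i-1}<t\le\tau_i,\quad \tau_0=0,$$ $F_T(0)=0$, and density $g_T$ (the left version at the $\tau_i$). Let $\pi_j(\theta)=F_T(t_j)-F_T(t_{j-1})$ for $j=1,\dots,L$, and $\pi_{L+1}(\theta)=1-F_T(t_L)$. Let $W(\theta)$ be the $(L+1)\times3$ matrix with rows $z_j-z_{j-1}$, where $z_0=z_{L+1}=0$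 and, for $1\le j\le L$ with $\tau_{i-1}<t_j\le\tau_i$, $$z_j=g_T(t_j)\begin{pmatrix}-(t_j+h_{i-1})\\-(t_j+h_{i-1})x_i+h^*_{i-1}\\ \log\big(\frac{t_j+h_{i-1}}{\lambda_i}\big)\frac{t_j+h_{i-1}}{\eta}\end{pmatrix},\qquad h_i^*=h_ix_{i+1}+\lambda_{i+1}\sum_{l=0}^{i-1}\Big(\frac{x_{i+1-l}}{\lambda_{i+1-l}}-\frac{x_{i-l}}{\lambda_{i-l}}\Big)\tau_{i-l},\quad h_0^*=0.$$ Let $D_\pi$ be the diagonal matrix with entries $\pi_j(\theta)$, and $\pi^\beta$ the vector with entries $\pi_j(\theta)^\beta$. For $\beta\ge0$ put $J_\beta=W^TD_\pi^{\beta-1}W$ and $K_\beta=W^T(D_\pi^{2\beta-1}-\pi^\beta(\pi^\beta)^T)W$. *Constraint.* Let $m:\Theta\to\mathbb R^r$ ($r\le3$) be differentiable, such that $M(\theta)=\partial m^T(\theta)/\partial\theta$ is continuous and of rank $r$ on $\Theta$. Put $\Theta_0=\{\theta\in\Theta: m(\theta)=0\}$ and $Q_\beta=J_\beta^{-1}M(M^TJ_\beta^{-1}M)^{-1}$.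 *Data and estimator.* For each $N$ let the vector of counts $(n_1,\dots,n_{L+1})$ be multinomial with $N$ trials and probabilities $\pi(\theta_0)$, where $\theta_0\in\Theta$ and $J_\beta(\theta_0)$ is invertible. Put $\hat p=(n_j/N)_j$ and $U_\beta(\theta)=W^TD_\pi^{\beta-1}(\hat p-\pi(\theta))$. The density power divergence is $$d_\beta(\hat p,\pi)=\sum_{j=1}^{L+1}\Big(\pi_j^{1+\beta}-\big(1+\tfrac1\beta\big)\hat p_j\pi_j^\beta+\tfrac1\beta\hat p_j^{\beta+1}\Big)\ (\beta>0),\qquad d_0(\hat p,\pi)=\sum_{j=1}^{L+1}\hat p_j\log\frac{\hat p_j}{\pi_j}.$$ The restricted estimating equations are $U_\beta(\theta)+M(\theta)\ell=0$ for some $\ell\in\mathbb R^r$, together with $m(\theta)=0$, $\theta\in\Theta$. A restricted minimum density power divergence estimator (RMDPDE) is a function $\tilde\theta_\beta$ of the counts that, with probability tending to one, either minimizes $d_\beta(\hat p,\pi(\theta))$ over $\theta\in\Theta_0$ or solves the restricted estimating equations. The Rao-type statistic is $$R_\beta(\theta)=N\,U_\beta(\theta)^TQ_\beta(\theta)\big[Q_\beta(\theta)^TK_\beta(\theta)Q_\beta(\theta)\big]^{-1}Q_\beta(\theta)^TU_\beta(\theta).$$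 *Claim.* Assume that the null hypothesis $m(\theta_0)=0$ holds. Then there is a sequence of estimators $\tilde\theta_\beta\xrightarrow{P}\theta_0$ that, with probability tending to one, solve the restricted estimating equations and are local minimizers of $d_\beta(\hat p,\pi(\theta))$ over $\Theta_0$. Moreover, for every sequence of RMDPDEs with $\tilde\theta_\beta\xrightarrow{P}\theta_0$, $R_\beta(\tilde\theta_\beta)$ converges in distribution, as $N\to\infty$, to a chi-square distribution with $r$ degrees of freedom. -/

import Mathlib

open MeasureTheory ProbabilityTheory Filter Topology
open scoped Matrix

noncomputable section

namespace StepStress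

/-- The parameter space `Θ = ℝ × ℝ⁻ × ℝ⁺` of vectors `θ = (a₀, a₁, η)`. -/
def paramSpace : Set (Fin 3 → ℝ) := {θ | θ 1 < 0 ∧ 0 < θ 2}

/-- A step-stress experiment with `k` stress levels `x₁ < ⋯ < x_k`, times of stress change
`0 < τ₁ < ⋯ < τ_{k-1}`, termination time `τ_k`, and inspection times `0 = t₀ < ⋯ < t_L = τ_k`
among which are all the `τ_i`. The values of `x`, `τ`, `t` at other indices play no role. -/
structure Design (k L : ℕ) where
  x : ℕ → ℝ
  τ : ℕ → ℝ
  t : ℕ → ℝ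
  one_le_k : 1 ≤ k
  x_strictMono : StrictMonoOn x (Set.Icc 1 k)
  τ_strictMono : StrictMonoOn τ (Set.Icc 1 k)
  τ_pos : 0 < τ 1
  t_zero : t 0 = 0
  t_strictMono : StrictMonoOn t (Set.Icc 0 L)
  τ_mem : ∀ i ∈ Set.Icc 1 k, ∃ j ∈ Set.Icc 1 L, t j = τ i
  t_last : t L = τ k

namespace Design

variable {k L : ℕ} (E : Design k L)

/-- The Weibull scale `λ_i = exp (a₀ + a₁ x_i)` at the `i`-th stress level. -/
def scale (θ : Fin 3 → ℝ) (i : ℕ) : ℝ := Real.exp (θ 0 + θ 1 * E.x i)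

/-- The shifting times of the cumulative exposure model: `h₀ = 0`, and `h_{i+1}` solves
`F_{i+2} (τ_{i+1} + h_{i+1}) = F_{i+1} (τ_{i+1} + h_i)`. -/
def shift (θ : Fin 3 → ℝ) : ℕ → ℝ
  | 0 => 0
  | i + 1 => E.scale θ (i + 2) / E.scale θ (i + 1) * (E.τ (i + 1) + shift θ i) - E.τ (i + 1)

/-- The index `i` of the stress level applied immediately before time `s`,
that is, `τ_{i-1} < s ≤ τ_i` (with `τ₀ = 0`) for `0 < s ≤ τ_k`. -/
def stage (s : ℝ) : ℕ := 1 + ((Finset.Icc 1 (k - 1)).filter fun i => E.τ i < s).card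

/-- The shifted time `s + h_{i-1}`, where `i` is the stage at time `s`. -/
def shifted (θ : Fin 3 → ℝ) (s : ℝ) : ℝ := s + E.shift θ (E.stage s - 1)

/-- The lifetime distribution function `F_T`. -/
def cdf (θ : Fin 3 → ℝ) (s : ℝ) : ℝ :=
  1 - Real.exp (-(E.shifted θ s / E.scale θ (E.stage s)) ^ θ 2)

/-- The lifetime density `g_T` (its left version at the times of stress change). -/
def pdf (θ : Fin 3 → ℝ) (s : ℝ) : ℝ :=
  θ 2 / E.scale θ (E.stage s) * (E.shifted θ s / E.scale θ (E.stage s)) ^ (θ 2 - 1) *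
    Real.exp (-(E.shifted θ s / E.scale θ (E.stage s)) ^ θ 2)

/-- The cell probabilities, numbered from `0`: cell `j < L` is failure in `(t_j, t_{j+1}]`,
and cell `L` is survival beyond `t_L`. -/
def prob (θ : Fin 3 → ℝ) (j : Fin (L + 1)) : ℝ :=
  if (j : ℕ) < L then E.cdf θ (E.t (j + 1)) - E.cdf θ (E.t j) else 1 - E.cdf θ (E.t L)

/-- `h_i^* = h_i x_{i+1} + λ_{i+1} ∑_{l=0}^{i-1} (x_{i+1-l}/λ_{i+1-l} - x_{i-l}/λ_{i-l}) τ_{i-l}`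
(so that `h_0^* = 0`). -/
def shiftStar (θ : Fin 3 → ℝ) (i : ℕ) : ℝ :=
  E.shift θ i * E.x (i + 1) + E.scale θ (i + 1) *
    ∑ l ∈ Finset.range i,
      (E.x (i + 1 - l) / E.scale θ (i + 1 - l) - E.x (i - l) / E.scale θ (i - l)) * E.τ (i - l)

/-- The vectors `z_j`, with `z_0 = z_{L+1} = 0`. -/
def z (θ : Fin 3 → ℝ) (j : ℕ) : Fin 3 → ℝ :=
  if 1 ≤ j ∧ j ≤ L then
    E.pdf θ (E.t j) •
      ![-E.shifted θ (E.t j),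
        -E.shifted θ (E.t j) * E.x (E.stage (E.t j)) + E.shiftStar θ (E.stage (E.t j) - 1),
        Real.log (E.shifted θ (E.t j) / E.scale θ (E.stage (E.t j))) *
          (E.shifted θ (E.t j) / θ 2)]
  else 0

/-- The `(L+1) × 3` matrix `W` with rows `z_j - z_{j-1}`, `j = 1, …, L+1`. -/
def W (θ : Fin 3 → ℝ) : Matrix (Fin (L + 1)) (Fin 3) ℝ :=
  Matrix.of fun j => E.z θ (j + 1) - E.z θ j

/-- The diagonal matrix `D_π^c`. -/
def D (θ : Fin 3 → ℝ) (c : ℝ) : Matrix (Fin (L + 1)) (Fin (L + 1)) ℝ :=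
  Matrix.diagonal fun j => E.prob θ j ^ c

/-- `J_β = Wᵀ D_π^{β-1} W`. -/
def J (β : ℝ) (θ : Fin 3 → ℝ) : Matrix (Fin 3) (Fin 3) ℝ :=
  (E.W θ)ᵀ * E.D θ (β - 1) * E.W θ

/-- `K_β = Wᵀ (D_π^{2β-1} - π^β (π^β)ᵀ) W`. -/
def K (β : ℝ) (θ : Fin 3 → ℝ) : Matrix (Fin 3) (Fin 3) ℝ :=
  (E.W θ)ᵀ * (E.D θ (2 * β - 1) -
    Matrix.vecMulVec (fun j => E.prob θ j ^ β) (fun j => E.prob θ j ^ β)) * E.W θ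

/-- The `β`-score `U_β = Wᵀ D_π^{β-1} (p̂ - π)` at the empirical probability vector `p`. -/
def U (β : ℝ) (p : Fin (L + 1) → ℝ) (θ : Fin 3 → ℝ) : Fin 3 → ℝ :=
  ((E.W θ)ᵀ * E.D θ (β - 1)) *ᵥ (p - E.prob θ)

end Design

/-- The density power divergence between two probability vectors; for `β = 0` it is the
Kullback-Leibler divergence. -/
def dpd {ι : Type*} [Fintype ι] (β : ℝ) (p q : ι → ℝ) : ℝ :=
  if β = 0 then ∑ j, p j * Real.log (p j / q j)
  else ∑ j, (q j ^ (1 + β) - (1 + 1 / β) * p j * q j ^ β + 1 / β * p j ^ (β + 1))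

/-- The restricted parameter space `Θ₀ = {θ ∈ Θ : m θ = 0}`. -/
def restrictedSpace {r : ℕ} (m : (Fin 3 → ℝ) → (Fin r → ℝ)) : Set (Fin 3 → ℝ) :=
  {θ | θ ∈ paramSpace ∧ m θ = 0}

/-- The `3 × r` matrix `M = ∂mᵀ/∂θ`, with entries `∂m_b/∂θ_a`. -/
def constraintMatrix {r : ℕ} (m : (Fin 3 → ℝ) → (Fin r → ℝ)) (θ : Fin 3 → ℝ) :
    Matrix (Fin 3) (Fin r) ℝ :=
  Matrix.of fun a b => fderiv ℝ m θ (Pi.single a 1) b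

/-- The empirical probability vector `p̂ = n / N`. -/
def empirical {L : ℕ} (N : ℕ) (n : Fin (L + 1) → ℕ) : Fin (L + 1) → ℝ :=
  fun j => (n j : ℝ) / N

/-- The distribution on the cells given by a probability vector. -/
def categorical {L : ℕ} (q : Fin (L + 1) → ℝ) : Measure (Fin (L + 1)) :=
  ∑ j, ENNReal.ofReal (q j) • Measure.dirac j

/-- The multinomial distribution: the law of the cell counts of `N` independent units, each of
which falls into cell `j` with probability `q j`. -/
def multinomial {L : ℕ} (N : ℕ) (q : Fin (L + 1) → ℝ) : Measure (Fin (L + 1) → ℕ) :=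
  (Measure.pi fun _ : Fin N => categorical q).map
    fun c j => (Finset.univ.filter fun i => c i = j).card

/-- The chi-square distribution with `r` degrees of freedom: the law of the sum of the squares of
`r` independent standard normal variables. -/
def chiSquare (r : ℕ) : Measure ℝ :=
  (Measure.pi fun _ : Fin r => gaussianReal 0 1).map fun v => ∑ i, v i ^ 2

instance (r : ℕ) : IsProbabilityMeasure (chiSquare r) :=
  Measure.isProbabilityMeasure_map (Measurable.aemeasurable (by fun_prop))

namespace Design

variable {k L r : ℕ} (E : Design k L)

/-- `Q_β = J_β⁻¹ M (Mᵀ J_β⁻¹ M)⁻¹`. -/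
def Q (β : ℝ) (m : (Fin 3 → ℝ) → (Fin r → ℝ)) (θ : Fin 3 → ℝ) : Matrix (Fin 3) (Fin r) ℝ :=
  (E.J β θ)⁻¹ * constraintMatrix m θ *
    ((constraintMatrix m θ)ᵀ * (E.J β θ)⁻¹ * constraintMatrix m θ)⁻¹

/-- The Rao-type statistic `N Uᵀ Q (Qᵀ K Q)⁻¹ Qᵀ U` of the counts `n` of `N` units, at `θ`. -/
def rao (β : ℝ) (m : (Fin 3 → ℝ) → (Fin r → ℝ)) (N : ℕ) (n : Fin (L + 1) → ℕ)
    (θ : Fin 3 → ℝ) : ℝ :=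
  N * (E.U β (empirical N n) θ ⬝ᵥ
    ((E.Q β m θ * ((E.Q β m θ)ᵀ * E.K β θ * E.Q β m θ)⁻¹ * (E.Q β m θ)ᵀ) *ᵥ
      E.U β (empirical N n) θ))

/-- `θ` minimizes the density power divergence to `p` over the restricted parameter space. -/
def IsRestrictedMinimizer (β : ℝ) (m : (Fin 3 → ℝ) → (Fin r → ℝ)) (p : Fin (L + 1) → ℝ)
    (θ : Fin 3 → ℝ) : Prop :=
  θ ∈ restrictedSpace m ∧ IsMinOn (fun θ' => dpd β p (E.prob θ')) (restrictedSpace m) θ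

/-- `θ` is a local minimizer of the density power divergence to `p` over the restricted
parameter space. -/
def IsRestrictedLocalMinimizer (β : ℝ) (m : (Fin 3 → ℝ) → (Fin r → ℝ)) (p : Fin (L + 1) → ℝ)
    (θ : Fin 3 → ℝ) : Prop :=
  θ ∈ restrictedSpace m ∧ IsLocalMinOn (fun θ' => dpd β p (E.prob θ')) (restrictedSpace m) θ

/-- `θ` solves the estimating equations `U_β + M ℓ = 0`, `m = 0` for some vector `ℓ` of
Lagrange multipliers. -/
def IsRestrictedRoot (β : ℝ) (m : (Fin 3 → ℝ) → (Fin r → ℝ)) (p : Fin (L + 1) → ℝ)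
    (θ : Fin 3 → ℝ) : Prop :=
  θ ∈ restrictedSpace m ∧ ∃ ℓ : Fin r → ℝ, E.U β p θ + constraintMatrix m θ *ᵥ ℓ = 0

end Design

/-- The estimators `est N`, functions of the counts of `N` units, are consistent for `θ₀`. -/
def Consistent {L : ℕ} {Ω : Type*} [MeasurableSpace Ω] (P : Measure Ω)
    (n : ℕ → Ω → Fin (L + 1) → ℕ) (est : ℕ → (Fin (L + 1) → ℕ) → (Fin 3 → ℝ))
    (θ₀ : Fin 3 → ℝ) : Prop :=
  TendstoInMeasure P (fun N ω => est N (n N ω)) atTop fun _ => θ₀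

/-- The property `S N` of the counts of `N` units holds with probability tending to one. -/
def Asymptotically {L : ℕ} {Ω : Type*} [MeasurableSpace Ω] (P : Measure Ω)
    (n : ℕ → Ω → Fin (L + 1) → ℕ) (S : ℕ → (Fin (L + 1) → ℕ) → Prop) : Prop :=
  Tendsto (fun N => P {ω | S N (n N ω)}) atTop (𝓝 1)

end StepStress

end

noncomputable section

namespace StepStress

/-! The matrix `W` is the Jacobian of the cell probabilities (`hasStrictFDerivAt_prob`), and its
columns sum to zero, so the divergence has gradient `-(1 + β) U` (`hasStrictFDerivAt_dpd`). Lagrange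
multipliers then turn every restricted local minimizer into a root of the estimating equations
(`isRestrictedRoot`).

Existence: at `p = π(θ₀)` the divergence is zero at `θ₀` and positive nearby, because `W` is
injective there. Minimizing over the part of `m = 0` in a small closed ball therefore gives a
function of `p` that tends to `θ₀` as `p → π(θ₀)` and whose values are eventually local minimizers
(`exists_tendsto_localMinimizer`). It is evaluated at the empirical frequencies.

Distribution: write `u = p̂ - π(θ₀)`, `δ = θ - θ₀`, `A = Wᵀ D^(β-1)`. To first order `U ≈ A₀ u - J₀
δ`. At a root `U` lies in the range of `M`, and `Qᵀ M = 1`. Moreover `Q₀ᵀ J₀` is a matrix times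
`M₀ᵀ`, while `M₀ᵀ δ = o(δ)` because `m` vanishes at both points. Hence `Qᵀ U = Q₀ᵀ A₀ u + o(u)`
(`isLittleO_projected_score`). No rate for the estimator is assumed: `δ = O(u)` comes out of the
same equations, so consistency is enough. Since `√N u` is bounded in probability, the remainder
vanishes after scaling.

The limit covariance of `√N Qᵀ U` is `S = Qᵀ K Q`, which is positive definite (`S_posDef`). With `T
Tᵀ = S`, the whitened vector `T⁻¹ √N Qᵀ U` tends to a standard normal vector by a central limit
theorem through characteristic functions. The Rao statistic is a quadratic form in it whose matrix
tends to the identity, so Slutsky's theorem gives the chi-square limit. -/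

lemma isOpen_paramSpace : IsOpen paramSpace := by
  have h1 : IsOpen {θ : Fin 3 → ℝ | θ 1 < 0} := isOpen_lt (by fun_prop) (by fun_prop)
  have h2 : IsOpen {θ : Fin 3 → ℝ | 0 < θ 2} := isOpen_lt (by fun_prop) (by fun_prop)
  exact h1.inter h2

/-! ### The cumulative exposure model: positivity of the cell probabilities and their Jacobian. -/

namespace Design

variable {k L : ℕ} (E : Design k L)

lemma scale_pos (θ : Fin 3 → ℝ) (i : ℕ) : 0 < E.scale θ i := Real.exp_pos _

/-- The cumulative exposure at time `s`, for the Weibull distribution with unit scale. -/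
def exposure (θ : Fin 3 → ℝ) (s : ℝ) : ℝ := E.shifted θ s / E.scale θ (E.stage s)

/-- The defining equation of the shifts: the exposure is continuous across a change of stress. -/
lemma exposure_shift (θ : Fin 3 → ℝ) (i : ℕ) :
    (E.τ (i + 1) + E.shift θ (i + 1)) / E.scale θ (i + 2) =
      (E.τ (i + 1) + E.shift θ i) / E.scale θ (i + 1) := by
  have h1 := (E.scale_pos θ (i + 1)).ne'
  have h2 := (E.scale_pos θ (i + 2)).ne'
  simp only [shift]
  field_simp
  ring

lemma stage_sub_one_le (s : ℝ) : E.stage s - 1 ≤ k - 1 := by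
  have := Finset.card_filter_le (Finset.Icc 1 (k - 1)) fun i => E.τ i < s
  simp only [stage, Nat.card_Icc] at *
  omega

lemma stage_sub_one_add_one (s : ℝ) : E.stage s - 1 + 1 = E.stage s := by
  simp only [stage]; omega

/-- As the `τ i` increase, those below `s` form an initial segment, so their number, which defines
`stage`, determines them. -/
lemma τ_lt_iff {s : ℝ} {i : ℕ} (hi : 1 ≤ i) (hik : i ≤ k - 1) :
    E.τ i < s ↔ i ≤ E.stage s - 1 := by
  have hst : E.stage s - 1 = ((Finset.Icc 1 (k - 1)).filter fun i => E.τ i < s).card := by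
    simp [stage]
  have hmono : ∀ a b, 1 ≤ a → a ≤ b → b ≤ k - 1 → E.τ a ≤ E.τ b := fun a b ha hab hb =>
    E.τ_strictMono.monotoneOn (Set.mem_Icc.2 (by omega)) (Set.mem_Icc.2 (by omega)) hab
  rw [hst]
  constructor
  · intro h
    have : Finset.Icc 1 i ⊆ (Finset.Icc 1 (k - 1)).filter fun i => E.τ i < s := by
      intro a ha
      rw [Finset.mem_Icc] at ha
      rw [Finset.mem_filter, Finset.mem_Icc]
      exact ⟨⟨ha.1, by omega⟩, (hmono a i ha.1 ha.2 hik).trans_lt h⟩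
    simpa using Finset.card_le_card this
  · intro h
    by_contra hlt
    have : ((Finset.Icc 1 (k - 1)).filter fun i => E.τ i < s) ⊆ Finset.Icc 1 (i - 1) := by
      intro a ha
      rw [Finset.mem_filter, Finset.mem_Icc] at ha
      rw [Finset.mem_Icc]
      refine ⟨ha.1.1, ?_⟩
      by_contra hai
      exact hlt ((hmono i a hi (by omega) ha.1.2).trans_lt ha.2)
    have := Finset.card_le_card this
    simp at this
    omega

lemma exposure_zero (θ : Fin 3 → ℝ) : E.exposure θ 0 = 0 := by
  have h : E.stage 0 = 1 := by
    have : ((Finset.Icc 1 (k - 1)).filter fun i => E.τ i < 0) = ∅ := by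
      refine Finset.filter_eq_empty_iff.2 fun i hi => ?_
      rw [Finset.mem_Icc] at hi
      have := E.τ_strictMono.monotoneOn (a := 1) (b := i) (Set.mem_Icc.2 (by omega))
        (Set.mem_Icc.2 (by omega)) hi.1
      have := E.τ_pos
      linarith
    simp [stage, this]
  simp [exposure, shifted, h, shift]

/-- The exposure is affine with positive slope on each stage, and consecutive pieces agree at the
stress changes; `key` passes from one stage to the next. -/
lemma exposure_lt (θ : Fin 3 → ℝ) {s s' : ℝ} (h : s < s') :
    E.exposure θ s < E.exposure θ s' := by
  set e : ℕ → ℝ → ℝ := fun i u => (u + E.shift θ i) / E.scale θ (i + 1) with he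
  have hexp : ∀ u, E.exposure θ u = e (E.stage u - 1) u := fun u => by
    simp only [exposure, shifted, he, stage_sub_one_add_one]
  have hmono : ∀ i, StrictMono (e i) := fun i a b hab => by
    simp only [he]
    exact div_lt_div_of_pos_right (by linarith) (E.scale_pos _ _)
  have hstep : ∀ i, e (i + 1) (E.τ (i + 1)) = e i (E.τ (i + 1)) := E.exposure_shift θ
  rw [hexp, hexp]
  set c := E.stage s - 1 with hc
  set c' := E.stage s' - 1 with hc'
  have hck : c' ≤ k - 1 := E.stage_sub_one_le s'
  have hcc : c ≤ c' := by
    by_contra hlt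
    have h1 : E.τ c < s := (E.τ_lt_iff (by omega) (E.stage_sub_one_le s)).2 le_rfl
    have h2 := (E.τ_lt_iff (by omega) (E.stage_sub_one_le s)).1 (h1.trans h)
    omega
  obtain hcc | hcc := hcc.eq_or_lt
  · rw [← hcc]; exact hmono c h
  have key : ∀ d, c + 1 + d ≤ c' → e c s ≤ e (c + 1 + d) (E.τ (c + 1 + d)) := by
    intro d
    induction d with
    | zero =>
      intro hd
      have : s ≤ E.τ (c + 1) := by
        by_contra hlt
        have := (E.τ_lt_iff (by omega) (by omega)).1 (not_le.1 hlt)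
        omega
      rw [add_zero, hstep]
      exact (hmono c).monotone this
    | succ d ih =>
      intro hd
      refine (ih (by omega)).trans ?_
      rw [← add_assoc, hstep]
      exact (hmono _).monotone (E.τ_strictMono.monotoneOn (Set.mem_Icc.2 (by omega))
        (Set.mem_Icc.2 (by omega)) (by omega))
  have h1 := key (c' - (c + 1)) (by omega)
  rw [show c + 1 + (c' - (c + 1)) = c' by omega] at h1
  exact h1.trans_lt (hmono _ ((E.τ_lt_iff (by omega) hck).2 le_rfl))

lemma exposure_nonneg (θ : Fin 3 → ℝ) {s : ℝ} (h : 0 ≤ s) : 0 ≤ E.exposure θ s := by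
  obtain rfl | h := h.eq_or_lt
  · exact (E.exposure_zero θ).ge
  · exact (E.exposure_zero θ).ge.trans (E.exposure_lt θ h).le

lemma exposure_pos (θ : Fin 3 → ℝ) {s : ℝ} (h : 0 < s) : 0 < E.exposure θ s :=
  (E.exposure_zero θ).ge.trans_lt (E.exposure_lt θ h)

lemma cdf_eq (θ : Fin 3 → ℝ) (s : ℝ) :
    E.cdf θ s = 1 - Real.exp (-E.exposure θ s ^ θ 2) := rfl

lemma cdf_zero {θ : Fin 3 → ℝ} (hθ : θ ∈ paramSpace) : E.cdf θ 0 = 0 := by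
  rw [cdf_eq, exposure_zero, Real.zero_rpow hθ.2.ne']
  simp

lemma cdf_lt_one (θ : Fin 3 → ℝ) (s : ℝ) : E.cdf θ s < 1 := by
  rw [cdf_eq]
  linarith [Real.exp_pos (-E.exposure θ s ^ θ 2)]

lemma cdf_lt {θ : Fin 3 → ℝ} (hθ : θ ∈ paramSpace) {s s' : ℝ} (hs : 0 ≤ s) (h : s < s') :
    E.cdf θ s < E.cdf θ s' := by
  rw [cdf_eq, cdf_eq]
  have := Real.rpow_lt_rpow (E.exposure_nonneg θ hs) (E.exposure_lt θ h) hθ.2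
  have := Real.exp_lt_exp.2 (neg_lt_neg this)
  linarith

lemma t_lt {i j : ℕ} (hij : i < j) (hj : j ≤ L) : E.t i < E.t j :=
  E.t_strictMono (Set.mem_Icc.2 (by omega)) (Set.mem_Icc.2 (by omega)) hij

lemma t_pos {j : ℕ} (h : 1 ≤ j) (hj : j ≤ L) : 0 < E.t j :=
  E.t_zero.ge.trans_lt (E.t_lt h hj)

lemma t_nonneg {j : ℕ} (hj : j ≤ L) : 0 ≤ E.t j := by
  obtain rfl | h := Nat.eq_zero_or_pos j
  · exact E.t_zero.ge
  · exact (E.t_pos h hj).le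

lemma prob_pos {θ : Fin 3 → ℝ} (hθ : θ ∈ paramSpace) (j : Fin (L + 1)) : 0 < E.prob θ j := by
  unfold prob
  split_ifs with h
  · exact sub_pos.2 (E.cdf_lt hθ (E.t_nonneg h.le) (E.t_lt (Nat.lt_succ_self _) h))
  · exact sub_pos.2 (E.cdf_lt_one _ _)

lemma sum_prob {θ : Fin 3 → ℝ} (hθ : θ ∈ paramSpace) : ∑ j, E.prob θ j = 1 := by
  rw [Fin.sum_univ_castSucc]
  simp only [prob, Fin.val_castSucc, Fin.is_lt, if_true, Fin.val_last, lt_irrefl, if_false]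
  rw [Fin.sum_univ_eq_sum_range (fun j => E.cdf θ (E.t (j + 1)) - E.cdf θ (E.t j)),
    Finset.sum_range_sub fun j => E.cdf θ (E.t j), E.t_zero, E.cdf_zero hθ]
  ring

/-- Telescoping with zero end terms; the infinitesimal form of the probabilities having sum one. -/
lemma sum_W (θ : Fin 3 → ℝ) (a : Fin 3) : ∑ j, E.W θ j a = 0 := by
  simp only [W, Matrix.of_apply, Pi.sub_apply]
  rw [Fin.sum_univ_eq_sum_range (fun j => E.z θ (j + 1) a - E.z θ j a),
    Finset.sum_range_sub fun j => E.z θ j a]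
  simp [z]

/-- The linear functional `v ↦ ∑ a, c a * v a`. -/
def linearForm (c : Fin 3 → ℝ) : (Fin 3 → ℝ) →L[ℝ] ℝ :=
  ∑ a, c a • ContinuousLinearMap.proj (R := ℝ) (φ := fun _ : Fin 3 => ℝ) a

@[simp] lemma linearForm_apply (c v : Fin 3 → ℝ) : linearForm c v = c ⬝ᵥ v := by
  simp [linearForm, dotProduct]

lemma hasStrictFDerivAt_coord (a : Fin 3) (θ : Fin 3 → ℝ) :
    HasStrictFDerivAt (fun θ : Fin 3 → ℝ => θ a)
      (ContinuousLinearMap.proj (R := ℝ) (φ := fun _ : Fin 3 => ℝ) a) θ :=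
  (ContinuousLinearMap.proj (R := ℝ) (φ := fun _ : Fin 3 => ℝ) a).hasStrictFDerivAt

lemma hasStrictFDerivAt_scale_div (θ : Fin 3 → ℝ) (i j : ℕ) :
    HasStrictFDerivAt (fun θ => E.scale θ i / E.scale θ j)
      (linearForm ![0, E.scale θ i / E.scale θ j * (E.x i - E.x j), 0]) θ := by
  have h : (fun θ => E.scale θ i / E.scale θ j) =
      fun θ : Fin 3 → ℝ => Real.exp (θ 1 * (E.x i - E.x j)) := by
    funext θ
    rw [scale, scale, ← Real.exp_sub]
    congr 1; ring
  have h' := congrFun h θ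
  rw [h', h]
  refine (((hasStrictFDerivAt_coord 1 θ).mul_const (E.x i - E.x j)).exp).congr_fderiv ?_
  ext v
  simp [dotProduct, Fin.sum_univ_three]
  ring

/-- The recursion for the shifts, differentiated in `a₁`; the explicit sum defining `shiftStar`
solves it. -/
lemma shiftStar_succ (θ : Fin 3 → ℝ) (i : ℕ) :
    E.shiftStar θ (i + 1) = E.scale θ (i + 2) / E.scale θ (i + 1) *
      ((E.x (i + 2) - E.x (i + 1)) * (E.τ (i + 1) + E.shift θ i) + E.shiftStar θ i) := by
  have h1 := (E.scale_pos θ (i + 1)).ne'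
  have h2 := (E.scale_pos θ (i + 2)).ne'
  unfold shiftStar
  rw [Finset.sum_range_succ', shift]
  have hl : ∀ l, i + 1 + 1 - (l + 1) = i + 1 - l := fun l => by omega
  simp only [Nat.add_sub_add_right, Nat.sub_zero, add_assoc, Nat.reduceAdd]
  simp only [← add_assoc, hl]
  field_simp
  ring

lemma hasStrictFDerivAt_shift (θ : Fin 3 → ℝ) (i : ℕ) :
    HasStrictFDerivAt (fun θ => E.shift θ i) (linearForm ![0, E.shiftStar θ i, 0]) θ := by
  induction i with
  | zero =>
    simp only [shift]
    refine (hasStrictFDerivAt_const (0 : ℝ) θ).congr_fderiv ?_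
    ext v
    simp [shiftStar, shift, dotProduct, Fin.sum_univ_three]
  | succ i ih =>
    simp only [shift]
    refine (((E.hasStrictFDerivAt_scale_div θ (i + 2) (i + 1)).mul
      (ih.const_add (E.τ (i + 1)))).sub_const (E.τ (i + 1))).congr_fderiv ?_
    ext v
    rw [shiftStar_succ]
    simp [dotProduct, Fin.sum_univ_three]
    ring

lemma hasStrictFDerivAt_exposure (θ : Fin 3 → ℝ) (s : ℝ) :
    HasStrictFDerivAt (fun θ => E.exposure θ s)
      (linearForm ![-E.exposure θ s, E.shiftStar θ (E.stage s - 1) / E.scale θ (E.stage s) -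
        E.exposure θ s * E.x (E.stage s), 0]) θ := by
  have h : (fun θ => E.exposure θ s) = fun θ : Fin 3 → ℝ =>
      (s + E.shift θ (E.stage s - 1)) * Real.exp (-(θ 0 + θ 1 * E.x (E.stage s))) := by
    funext θ
    simp only [exposure, shifted, scale, Real.exp_neg, div_eq_mul_inv]
  rw [h]
  refine (((E.hasStrictFDerivAt_shift θ (E.stage s - 1)).const_add s).mul
    (((hasStrictFDerivAt_coord 0 θ).add
      ((hasStrictFDerivAt_coord 1 θ).mul_const (E.x (E.stage s)))).neg.exp)).congr_fderiv ?_
  ext v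
  simp only [exposure, shifted, scale, div_eq_mul_inv, ← Real.exp_neg]
  simp [dotProduct, Fin.sum_univ_three]
  ring

/-- The gradient in `θ` of the distribution function at time `s`. -/
def cdfGradient (θ : Fin 3 → ℝ) (s : ℝ) : Fin 3 → ℝ :=
  E.pdf θ s • ![-E.shifted θ s,
    -E.shifted θ s * E.x (E.stage s) + E.shiftStar θ (E.stage s - 1),
    Real.log (E.shifted θ s / E.scale θ (E.stage s)) * (E.shifted θ s / θ 2)]

lemma hasStrictFDerivAt_cdf {θ : Fin 3 → ℝ} (hθ : θ ∈ paramSpace) {s : ℝ} (hs : 0 < s) :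
    HasStrictFDerivAt (fun θ => E.cdf θ s) (linearForm (E.cdfGradient θ s)) θ := by
  have hpos := E.exposure_pos θ hs
  have hη : 0 < θ 2 := hθ.2
  have hsc := E.scale_pos θ (E.stage s)
  simp only [cdf_eq]
  refine ((((E.hasStrictFDerivAt_exposure θ s).rpow (hasStrictFDerivAt_coord 2 θ)
    hpos).neg.exp).const_sub 1).congr_fderiv ?_
  ext v
  have h1 : E.exposure θ s ^ θ 2 = E.exposure θ s ^ (θ 2 - 1) * E.exposure θ s := by
    rw [Real.rpow_sub_one hpos.ne']; field_simp
  have h2 : E.shifted θ s = E.exposure θ s * E.scale θ (E.stage s) := by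
    rw [exposure]; field_simp
  simp only [cdfGradient, pdf]
  rw [show E.shifted θ s / E.scale θ (E.stage s) = E.exposure θ s from rfl, h2]
  -- The exponential is hidden so that `h1` rewrites only the power outside it.
  generalize hX : Real.exp (-E.exposure θ s ^ θ 2) = X
  rw [h1]
  simp [dotProduct, Fin.sum_univ_three]
  field_simp
  ring

lemma hasStrictFDerivAt_cdf_t {θ : Fin 3 → ℝ} (hθ : θ ∈ paramSpace) {j : ℕ} (hj : j ≤ L) :
    HasStrictFDerivAt (fun θ => E.cdf θ (E.t j)) (linearForm (E.z θ j)) θ := by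
  obtain rfl | h := Nat.eq_zero_or_pos j
  -- At time zero the base of the power vanishes and the power rule is unavailable, but the
  -- distribution function is constantly zero on the open set `Θ`.
  · have h0 : (fun θ => E.cdf θ (E.t 0)) =ᶠ[𝓝 θ] fun _ => 0 := by
      filter_upwards [isOpen_paramSpace.mem_nhds hθ] with θ' hθ'
      rw [E.t_zero, E.cdf_zero hθ']
    refine ((hasStrictFDerivAt_const (0 : ℝ) θ).congr_of_eventuallyEq h0.symm).congr_fderiv ?_
    ext v
    simp [z]
  · have : E.z θ j = E.cdfGradient θ (E.t j) := by
      rw [z, if_pos ⟨h, hj⟩, cdfGradient]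
    rw [this]
    exact E.hasStrictFDerivAt_cdf hθ (E.t_pos h hj)

/-- The survival cell fits the same formula because `z` vanishes at index `L + 1`. Strictness is
what the multiplier theorem requires. -/
lemma hasStrictFDerivAt_prob {θ : Fin 3 → ℝ} (hθ : θ ∈ paramSpace) :
    HasStrictFDerivAt E.prob (Matrix.mulVecLin (E.W θ)).toContinuousLinearMap θ := by
  rw [hasStrictFDerivAt_pi']
  intro j
  by_cases h : (j : ℕ) < L
  · simp only [prob, h, if_true]
    refine ((E.hasStrictFDerivAt_cdf_t hθ h).sub
      (E.hasStrictFDerivAt_cdf_t hθ h.le)).congr_fderiv ?_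
    ext v
    simp [W, Matrix.mulVec, dotProduct, sub_mul]
  · have hj : (j : ℕ) = L := by omega
    simp only [prob, h, if_false]
    refine ((E.hasStrictFDerivAt_cdf_t hθ le_rfl).const_sub 1).congr_fderiv ?_
    ext v
    simp [W, Matrix.mulVec, dotProduct, hj, z]

lemma continuous_scale (i : ℕ) : Continuous fun θ => E.scale θ i := by
  unfold scale; fun_prop

lemma continuous_shift (i : ℕ) : Continuous fun θ => E.shift θ i :=
  continuous_iff_continuousAt.2 fun θ => (E.hasStrictFDerivAt_shift θ i).continuousAt

lemma continuous_shiftStar (i : ℕ) : Continuous fun θ => E.shiftStar θ i := by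
  unfold shiftStar
  refine ((E.continuous_shift i).mul continuous_const).add ((E.continuous_scale _).mul
    (continuous_finsetSum _ fun l _ => Continuous.mul ?_ continuous_const))
  exact (continuous_const.div (E.continuous_scale _) fun θ => (E.scale_pos θ _).ne').sub
    (continuous_const.div (E.continuous_scale _) fun θ => (E.scale_pos θ _).ne')

lemma continuousOn_cdfGradient {s : ℝ} (hs : 0 < s) :
    ContinuousOn (fun θ => E.cdfGradient θ s) paramSpace := by
  have h1 : ContinuousOn (fun θ : Fin 3 → ℝ => θ 2) paramSpace :=
    (continuous_apply 2).continuousOn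
  have h2 : ContinuousOn (fun θ => E.shifted θ s) paramSpace := by
    unfold shifted
    exact (continuous_const.add (E.continuous_shift _)).continuousOn
  have h3 : ContinuousOn (fun θ => E.scale θ (E.stage s)) paramSpace :=
    (E.continuous_scale _).continuousOn
  have h4 : ContinuousOn (fun θ => E.shifted θ s / E.scale θ (E.stage s)) paramSpace :=
    h2.div h3 fun θ _ => (E.scale_pos θ _).ne'
  have h5 : ∀ θ, E.shifted θ s / E.scale θ (E.stage s) ≠ 0 := fun θ => (E.exposure_pos θ hs).ne'
  have h6 : ContinuousOn (fun θ => E.pdf θ s) paramSpace := by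
    unfold pdf
    refine ((h1.div h3 fun θ _ => (E.scale_pos θ _).ne').mul
      (h4.rpow (h1.sub continuousOn_const) fun θ _ => Or.inl (h5 θ))).mul ?_
    exact Real.continuous_exp.comp_continuousOn (h4.rpow h1 fun θ _ => Or.inl (h5 θ)).neg
  unfold cdfGradient
  refine h6.smul (continuousOn_pi.2 fun a => ?_)
  fin_cases a
  · exact h2.neg
  · exact (h2.neg.mul continuousOn_const).add (E.continuous_shiftStar _).continuousOn
  · exact (h4.log fun θ _ => h5 θ).mul (h2.div h1 fun θ hθ => hθ.2.ne')

lemma continuousOn_z (j : ℕ) : ContinuousOn (fun θ => E.z θ j) paramSpace := by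
  by_cases h : 1 ≤ j ∧ j ≤ L
  · simp only [z, if_pos h]
    exact E.continuousOn_cdfGradient (E.t_pos h.1 h.2)
  · simp only [z, if_neg h]
    exact continuousOn_const

lemma continuousOn_W : ContinuousOn E.W paramSpace := by
  refine continuousOn_pi.2 fun j => ?_
  exact (E.continuousOn_z _).sub (E.continuousOn_z _)

lemma continuousOn_prob : ContinuousOn E.prob paramSpace := fun _ hθ =>
  (E.hasStrictFDerivAt_prob hθ).continuousAt.continuousWithinAt

lemma continuousOn_D (c : ℝ) : ContinuousOn (fun θ => E.D θ c) paramSpace := by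
  unfold D
  refine Continuous.comp_continuousOn (g := Matrix.diagonal) (by fun_prop) ?_
  exact continuousOn_pi.2 fun j => ((continuousOn_pi.1 E.continuousOn_prob) j).rpow
    continuousOn_const fun θ hθ => Or.inl (E.prob_pos hθ j).ne'

end Design

/-! ### The constraint and its derivative. -/

lemma mulVec_injective_of_rank_eq {ι : Type*} [Fintype ι] {r : ℕ} {A : Matrix ι (Fin r) ℝ}
    (h : A.rank = r) : Function.Injective A.mulVec := by
  have h1 := LinearMap.finrank_range_add_finrank_ker A.mulVecLin
  rw [show Module.finrank ℝ A.mulVecLin.range = r from h] at h1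
  simp only [Module.finrank_fintype_fun_eq_card, Fintype.card_fin] at h1
  have h2 : LinearMap.ker A.mulVecLin = ⊥ := Submodule.finrank_eq_zero.1 (by omega)
  exact LinearMap.ker_eq_bot.1 h2

section Constraint

variable {r : ℕ} {m : (Fin 3 → ℝ) → (Fin r → ℝ)}

lemma fderiv_eq_constraintMatrix (θ v : Fin 3 → ℝ) :
    fderiv ℝ m θ v = (constraintMatrix m θ)ᵀ *ᵥ v := by
  conv_lhs => rw [pi_eq_sum_univ' v]
  ext b
  simp only [map_sum, map_smul, Finset.sum_apply, Pi.smul_apply, smul_eq_mul, Matrix.mulVec,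
    dotProduct, Matrix.transpose_apply, constraintMatrix, Matrix.of_apply]
  refine Finset.sum_congr rfl fun a _ => ?_
  rw [mul_comm]

lemma hasStrictFDerivAt_constraint (hm : ∀ θ ∈ paramSpace, DifferentiableAt ℝ m θ)
    (hM : ContinuousOn (constraintMatrix m) paramSpace) {θ : Fin 3 → ℝ} (hθ : θ ∈ paramSpace) :
    HasStrictFDerivAt m (Matrix.mulVecLin (constraintMatrix m θ)ᵀ).toContinuousLinearMap θ := by
  have heq : ∀ θ, fderiv ℝ m θ =
      (Matrix.mulVecLin (constraintMatrix m θ)ᵀ).toContinuousLinearMap := fun θ => by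
    ext1 v
    exact fderiv_eq_constraintMatrix θ v
  rw [← heq]
  refine hasStrictFDerivAt_of_hasFDerivAt_of_continuousAt (f' := fderiv ℝ m) ?_ ?_
  · filter_upwards [isOpen_paramSpace.mem_nhds hθ] with θ' hθ' using (hm θ' hθ').hasFDerivAt
  · rw [continuousAt_clm_apply]
    intro v
    simp_rw [fderiv_eq_constraintMatrix]
    have : ContinuousAt (constraintMatrix m) θ :=
      hM.continuousAt (isOpen_paramSpace.mem_nhds hθ)
    exact (Continuous.continuousAt (f := fun A : Matrix (Fin 3) (Fin r) ℝ => Aᵀ *ᵥ v)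
      (by fun_prop)).comp this

end Constraint

/-! ### The density power divergence, cell by cell. -/

section Divergence

variable {ι : Type*} [Fintype ι]

/-- The contribution of one cell to the density power divergence. -/
def dpdTerm (β p q : ℝ) : ℝ :=
  if β = 0 then p * Real.log (p / q)
  else q ^ (1 + β) - (1 + 1 / β) * p * q ^ β + 1 / β * p ^ (β + 1)

lemma dpd_eq_sum (β : ℝ) (p q : ι → ℝ) : dpd β p q = ∑ j, dpdTerm β (p j) (q j) := by
  unfold dpd dpdTerm
  split_ifs <;> rfl

lemma dpdTerm_self (β : ℝ) {p : ℝ} (hp : 0 < p) : dpdTerm β p p = 0 := by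
  unfold dpdTerm
  split_ifs with h
  · simp [div_self hp.ne']
  · rw [add_comm 1 β, Real.rpow_add hp, Real.rpow_one]
    field_simp
    ring

/-- Both cases rest on `log x < x - 1` at `x = q / p ≠ 1`; for `β > 0` it is combined with `exp y ≥
1 + y` at `y = -β log x`. For `β = 0` single terms may be negative; the bound `p - q` cancels only
in the sum over cells. -/
lemma lt_dpdTerm {β p q : ℝ} (hβ : 0 ≤ β) (hp : 0 < p) (hq : 0 < q) (hpq : p ≠ q) :
    (if β = 0 then p - q else 0) < dpdTerm β p q := by
  have hlog : Real.log (q / p) < q / p - 1 := by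
    refine Real.log_lt_sub_one_of_pos (by positivity) ?_
    rw [ne_eq, div_eq_one_iff_eq hp.ne']
    exact hpq.symm
  unfold dpdTerm
  split_ifs with h
  · rw [show p / q = (q / p)⁻¹ by rw [inv_div], Real.log_inv]
    have := mul_lt_mul_of_pos_left hlog hp
    rw [mul_sub, mul_div_cancel₀ _ hp.ne'] at this
    linarith
  · have hβ' : 0 < β := lt_of_le_of_ne hβ (Ne.symm h)
    have hexp := Real.add_one_le_exp (-(β * Real.log (q / p)))
    have hpow : Real.exp (-(β * Real.log (q / p))) = p ^ β / q ^ β := by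
      rw [Real.exp_neg, mul_comm, ← Real.rpow_def_of_pos (by positivity),
        Real.div_rpow hq.le hp.le, inv_div]
    rw [hpow] at hexp
    have h1 : 1 + β < β * (q / p) + p ^ β / q ^ β := by nlinarith
    have hqβ := Real.rpow_pos_of_pos hq β
    rw [add_comm 1 β, Real.rpow_add hq, Real.rpow_add hp, Real.rpow_one, Real.rpow_one]
    have h2 : q ^ β * q - (1 + 1 / β) * p * q ^ β + 1 / β * (p ^ β * p) =
        p * q ^ β / β * (β * (q / p) + p ^ β / q ^ β - (1 + β)) := by
      field_simp
      ring
    rw [h2]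
    exact mul_pos (by positivity) (by linarith)

lemma dpd_self (β : ℝ) {p : ι → ℝ} (hp : ∀ j, 0 < p j) : dpd β p p = 0 := by
  rw [dpd_eq_sum]
  exact Finset.sum_eq_zero fun j _ => dpdTerm_self β (hp j)

lemma dpd_pos {β : ℝ} (hβ : 0 ≤ β) {p q : ι → ℝ} (hp : ∀ j, 0 < p j) (hq : ∀ j, 0 < q j)
    (hsum : ∑ j, p j = ∑ j, q j) (hpq : q ≠ p) : 0 < dpd β p q := by
  have h0 : ∑ j, (if β = 0 then p j - q j else 0) = 0 := by
    split_ifs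
    · rw [Finset.sum_sub_distrib, hsum, sub_self]
    · simp
  rw [dpd_eq_sum, ← h0]
  obtain ⟨j, hj⟩ := Function.ne_iff.1 hpq
  refine Finset.sum_lt_sum (fun i _ => ?_)
    ⟨j, Finset.mem_univ _, lt_dpdTerm hβ (hp j) (hq j) hj.symm⟩
  by_cases h : p i = q i
  · rw [← h, dpdTerm_self β (hp i)]
    simp
  · exact (lt_dpdTerm hβ (hp i) (hq i) h).le

/-- The extra constant at `β = 0` puts `-p / q` into the shape common to all `β`; it disappears on
summation by `sum_W`. -/
lemma hasStrictDerivAt_dpdTerm {β : ℝ} (hβ : 0 ≤ β) (p : ℝ) {q : ℝ} (hq : 0 < q) :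
    HasStrictDerivAt (dpdTerm β p)
      (-(1 + β) * (q ^ (β - 1) * (p - q)) - if β = 0 then 1 else 0) q := by
  unfold dpdTerm
  split_ifs with h
  · subst h
    -- An empty cell needs its own argument, as the logarithm is then taken at zero; the term is
    -- constant.
    by_cases hp : p = 0
    · subst hp
      simp only [zero_mul]
      convert! hasStrictDerivAt_const q (0 : ℝ) using 1
      rw [zero_sub, Real.rpow_neg_one]
      field_simp
      ring
    · convert! (((hasStrictDerivAt_const q p).div (hasStrictDerivAt_id q) hq.ne').log
        (div_ne_zero hp hq.ne')).const_mul p using 1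
      rw [zero_sub, Real.rpow_neg_one]
      simp only [id, Pi.div_apply]
      field_simp
      ring
  · have hr := fun c : ℝ => Real.hasStrictDerivAt_rpow_const_of_ne hq.ne' c
    convert! ((hr (1 + β)).sub ((hr β).const_mul ((1 + 1 / β) * p))).add_const
      (1 / β * p ^ (β + 1)) using 1
    rw [show (1 + β - 1 : ℝ) = β - 1 + 1 by ring, Real.rpow_add hq, Real.rpow_one]
    field_simp
    ring

lemma continuousAt_dpdTerm {β p q : ℝ} (hp : 0 < p) (hq : 0 < q) :
    ContinuousAt (fun x : ℝ × ℝ => dpdTerm β x.1 x.2) (p, q) := by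
  unfold dpdTerm
  have h1 : ContinuousAt (fun x : ℝ × ℝ => x.1) (p, q) := continuousAt_fst
  have h2 : ContinuousAt (fun x : ℝ × ℝ => x.2) (p, q) := continuousAt_snd
  split_ifs with h
  · exact h1.mul ((h1.div h2 hq.ne').log (div_pos hp hq).ne')
  · exact ((h2.rpow_const (Or.inl hq.ne')).sub ((continuousAt_const.mul h1).mul
      (h2.rpow_const (Or.inl hq.ne')))).add
      (continuousAt_const.mul (h1.rpow_const (Or.inl hp.ne')))

lemma continuousAt_dpd {β : ℝ} {p q : ι → ℝ} (hp : ∀ j, 0 < p j) (hq : ∀ j, 0 < q j) :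
    ContinuousAt (fun x : (ι → ℝ) × (ι → ℝ) => dpd β x.1 x.2) (p, q) := by
  simp only [dpd_eq_sum]
  refine tendsto_finsetSum _ fun j _ => ?_
  exact ContinuousAt.comp (f := fun x : (ι → ℝ) × (ι → ℝ) => (x.1 j, x.2 j)) (x := (p, q))
    (continuousAt_dpdTerm (hp j) (hq j)) (Continuous.continuousAt (by fun_prop))

end Divergence

/-! ### Estimating equations, and local minimizers near the true parameter. -/

namespace Design

variable {k L r : ℕ} (E : Design k L) {m : (Fin 3 → ℝ) → (Fin r → ℝ)}

lemma U_apply (β : ℝ) (p : Fin (L + 1) → ℝ) (θ : Fin 3 → ℝ) (a : Fin 3) :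
    E.U β p θ a = ∑ j, E.W θ j a * (E.prob θ j ^ (β - 1) * (p j - E.prob θ j)) := by
  simp [U, D, Matrix.mulVec, dotProduct, mul_assoc]

lemma hasStrictFDerivAt_dpd {β : ℝ} (hβ : 0 ≤ β) (p : Fin (L + 1) → ℝ) {θ : Fin 3 → ℝ}
    (hθ : θ ∈ paramSpace) :
    HasStrictFDerivAt (fun θ => dpd β p (E.prob θ)) (linearForm (-(1 + β) • E.U β p θ)) θ := by
  simp only [dpd_eq_sum]
  have h := fun j => hasStrictFDerivAt_pi'.1 (E.hasStrictFDerivAt_prob hθ) j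
  refine (HasStrictFDerivAt.fun_sum fun j _ =>
    (hasStrictDerivAt_dpdTerm hβ (p j) (E.prob_pos hθ j)).comp_hasStrictFDerivAt θ
      (h j)).congr_fderiv ?_
  ext1 v
  have hW : ∑ j, (E.W θ *ᵥ v) j = 0 := by
    simp only [Matrix.mulVec, dotProduct]
    rw [Finset.sum_comm]
    simp [← Finset.sum_mul, E.sum_W]
  have hU : (-(1 + β) • E.U β p θ) ⬝ᵥ v =
      ∑ j, -(1 + β) * (E.prob θ j ^ (β - 1) * (p j - E.prob θ j)) * (E.W θ *ᵥ v) j := by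
    simp only [dotProduct, Matrix.mulVec, Pi.smul_apply, U_apply, smul_eq_mul, Finset.mul_sum,
      Finset.sum_mul]
    rw [Finset.sum_comm]
    exact Finset.sum_congr rfl fun j _ => Finset.sum_congr rfl fun a _ => by ring
  rw [linearForm_apply, hU]
  simp only [_root_.sum_apply, _root_.smul_apply,
    ContinuousLinearMap.comp_apply, ContinuousLinearMap.proj_apply, smul_eq_mul,
    LinearMap.coe_toContinuousLinearMap', Matrix.mulVecLin_apply, sub_mul,
    Finset.sum_sub_distrib, ← Finset.mul_sum, hW, mul_zero, sub_zero]

lemma IsRestrictedLocalMinimizer.isRestrictedRoot {β : ℝ} (hβ : 0 ≤ β)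
    (hm : ∀ θ ∈ paramSpace, DifferentiableAt ℝ m θ)
    (hM : ContinuousOn (constraintMatrix m) paramSpace)
    (hrank : ∀ θ ∈ paramSpace, (constraintMatrix m θ).rank = r)
    {p : Fin (L + 1) → ℝ} {θ : Fin 3 → ℝ} (h : E.IsRestrictedLocalMinimizer β m p θ) :
    E.IsRestrictedRoot β m p θ := by
  obtain ⟨⟨hθ, hmθ⟩, hmin⟩ := h
  refine ⟨⟨hθ, hmθ⟩, ?_⟩
  have hset : {x | ∀ b, m x b = m θ b} = {x | m x = 0} := by
    ext x
    simp [hmθ, funext_iff]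
  have hext : IsLocalExtrOn (fun θ' => dpd β p (E.prob θ')) {x | ∀ b, m x b = m θ b} θ := by
    left
    rw [hset]
    -- The multiplier theorem concerns the whole level set of `m`; intersecting it with the open set
    -- `Θ` changes nothing near `θ`.
    have : 𝓝[{x | m x = 0}] θ = 𝓝[restrictedSpace m] θ := by
      rw [show restrictedSpace m = paramSpace ∩ {x | m x = 0} from rfl, Set.inter_comm]
      exact nhdsWithin_restrict _ hθ isOpen_paramSpace
    rw [IsMinFilter, this]
    exact hmin
  obtain ⟨Λ, Λ₀, hne, hsum⟩ := hext.exists_multipliers_of_hasStrictFDerivAt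
    (fun b => hasStrictFDerivAt_pi'.1 (hasStrictFDerivAt_constraint hm hM hθ) b)
    (E.hasStrictFDerivAt_dpd hβ p hθ)
  have hvec : constraintMatrix m θ *ᵥ Λ = (Λ₀ * (1 + β)) • E.U β p θ := by
    ext a
    have := DFunLike.congr_fun hsum (Pi.single a 1)
    simp at this
    simp only [Matrix.mulVec, dotProduct, Pi.smul_apply, smul_eq_mul]
    rw [Finset.sum_congr rfl fun b _ => mul_comm (constraintMatrix m θ a b) (Λ b)]
    linarith
  -- A zero multiplier of the objective would give a nontrivial relation between the columns of `M`,
  -- against full rank.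
  have hΛ₀ : Λ₀ ≠ 0 := by
    rintro rfl
    refine hne (Prod.ext ?_ rfl)
    refine mulVec_injective_of_rank_eq (hrank θ hθ) ?_
    simpa using hvec
  refine ⟨-(Λ₀ * (1 + β))⁻¹ • Λ, ?_⟩
  have h1 : 1 + β ≠ 0 := by positivity
  rw [Matrix.mulVec_smul, hvec, smul_smul, neg_mul, inv_mul_cancel₀ (mul_ne_zero hΛ₀ h1)]
  simp

lemma IsRestrictedMinimizer.isRestrictedLocalMinimizer {β : ℝ} {p : Fin (L + 1) → ℝ}
    {θ : Fin 3 → ℝ} (h : E.IsRestrictedMinimizer β m p θ) :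
    E.IsRestrictedLocalMinimizer β m p θ := ⟨h.1, h.2.localize⟩

lemma exists_tendsto_localMinimizer {β : ℝ} (hβ : 0 ≤ β) (hmc : ContinuousOn m paramSpace)
    {θ₀ : Fin 3 → ℝ} (hθ₀ : θ₀ ∈ paramSpace) (hW : Function.Injective (E.W θ₀).mulVec)
    (hnull : m θ₀ = 0) :
    ∃ T : (Fin (L + 1) → ℝ) → (Fin 3 → ℝ), Tendsto T (𝓝 (E.prob θ₀)) (𝓝 θ₀) ∧
      ∀ᶠ p in 𝓝 (E.prob θ₀), E.IsRestrictedLocalMinimizer β m p (T p) := by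
  -- Local identifiability: an injective derivative in finite dimension is bounded below.
  have hne : ∀ᶠ θ in 𝓝 θ₀, θ ≠ θ₀ → E.prob θ ≠ E.prob θ₀ := by
    refine eventually_nhdsWithin_iff.1 (?_ : ∀ᶠ θ in 𝓝[≠] θ₀, E.prob θ ≠ E.prob θ₀)
    refine (E.hasStrictFDerivAt_prob hθ₀).hasFDerivAt.eventually_ne ?_
    obtain ⟨K, -, hK⟩ := LinearMap.exists_antilipschitzWith (Matrix.mulVecLin (E.W θ₀))
      (LinearMap.ker_eq_bot.2 hW)
    exact ⟨K, hK⟩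
  obtain ⟨ε, hε, hball⟩ := Metric.nhds_basis_closedBall.mem_iff.1
    (hne.and (isOpen_paramSpace.mem_nhds hθ₀))
  have hΘ : ∀ θ ∈ Metric.closedBall θ₀ ε, θ ∈ paramSpace := fun θ hθ => (hball hθ).2
  set C : Set (Fin 3 → ℝ) := Metric.closedBall θ₀ ε ∩ m ⁻¹' {0} with hC
  have hCΘ : ∀ θ ∈ C, θ ∈ paramSpace := fun θ hθ => hΘ θ hθ.1
  have hCcpt : IsCompact C := (isCompact_closedBall θ₀ ε).of_isClosed_subset
    ((hmc.mono hΘ).preimage_isClosed_of_isClosed Metric.isClosed_closedBall isClosed_singleton)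
    Set.inter_subset_left
  have hθ₀C : θ₀ ∈ C := ⟨Metric.mem_closedBall_self hε.le, hnull⟩
  have hmin : ∀ p, ∃ θ ∈ C, IsMinOn (fun θ' => dpd β p (E.prob θ')) C θ := fun p =>
    hCcpt.exists_isMinOn ⟨θ₀, hθ₀C⟩ fun θ hθ =>
      (E.hasStrictFDerivAt_dpd hβ p (hCΘ θ hθ)).continuousAt.continuousWithinAt
  choose T hTC hTmin using hmin
  have hT : Tendsto T (𝓝 (E.prob θ₀)) (𝓝 θ₀) := by
    rw [Metric.nhds_basis_ball.tendsto_right_iff]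
    intro δ hδ
    have hcpt : IsCompact (C \ Metric.ball θ₀ δ) := hCcpt.diff Metric.isOpen_ball
    have hev : ∀ᶠ p in 𝓝 (E.prob θ₀), ∀ θ ∈ C \ Metric.ball θ₀ δ,
        dpd β p (E.prob θ₀) < dpd β p (E.prob θ) := by
      -- Compactness makes uniform in `θ` a strict inequality that holds at `p = π(θ₀)` and is
      -- jointly continuous there.
      refine hcpt.eventually_forall_of_forall_eventually fun θ hθ => ?_
      have hθΘ := hCΘ θ hθ.1
      have hθne : θ ≠ θ₀ := by
        rintro rfl
        exact hθ.2 (Metric.mem_ball_self hδ)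
      have c1 : ContinuousAt (fun z : (Fin (L + 1) → ℝ) × (Fin 3 → ℝ) =>
          dpd β z.1 (E.prob θ₀)) (E.prob θ₀, θ) :=
        ContinuousAt.comp (f := fun z : (Fin (L + 1) → ℝ) × (Fin 3 → ℝ) => (z.1, E.prob θ₀))
          (x := (E.prob θ₀, θ)) (continuousAt_dpd (E.prob_pos hθ₀) (E.prob_pos hθ₀))
          (Continuous.continuousAt (by fun_prop))
      have c2 : ContinuousAt (fun z : (Fin (L + 1) → ℝ) × (Fin 3 → ℝ) =>
          dpd β z.1 (E.prob z.2)) (E.prob θ₀, θ) :=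
        ContinuousAt.comp (f := fun z : (Fin (L + 1) → ℝ) × (Fin 3 → ℝ) => (z.1, E.prob z.2))
          (x := (E.prob θ₀, θ)) (continuousAt_dpd (E.prob_pos hθ₀) (E.prob_pos hθΘ))
          (continuousAt_fst.prodMk (ContinuousAt.comp (f := Prod.snd) (x := (E.prob θ₀, θ))
            (E.hasStrictFDerivAt_prob hθΘ).continuousAt continuousAt_snd))
      refine c1.eventually_lt c2 ?_
      simp only
      rw [dpd_self β (E.prob_pos hθ₀)]
      exact dpd_pos hβ (E.prob_pos hθ₀) (E.prob_pos hθΘ)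
        ((E.sum_prob hθ₀).trans (E.sum_prob hθΘ).symm) ((hball hθ.1.1).1 hθne)
    filter_upwards [hev] with p hp
    by_contra hnot
    exact absurd (hTmin p hθ₀C) (not_le.2 (hp (T p) ⟨hTC p, hnot⟩))
  refine ⟨T, hT, ?_⟩
  -- Once `T p` is inside the open ball, nearby points of `Θ₀` belong to `C`, so the minimum over
  -- `C` is local over `Θ₀`.
  filter_upwards [hT.eventually (Metric.ball_mem_nhds θ₀ hε)] with p hp
  refine ⟨⟨hCΘ _ (hTC p), (hTC p).2⟩, ?_⟩
  filter_upwards [mem_nhdsWithin_of_mem_nhds (Metric.isOpen_ball.mem_nhds hp),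
    self_mem_nhdsWithin] with θ hθ hθr
  exact hTmin p ⟨Metric.ball_subset_closedBall hθ, hθr.2⟩

end Design

/-! ### Matrix limits and the linearization of the estimating equations. -/

section MatrixAnalysis

open Asymptotics

lemma tendsto_matrix_inv {α n : Type*} [Fintype n] [DecidableEq n] {F : Filter α}
    {A : α → Matrix n n ℝ} {A₀ : Matrix n n ℝ} (hA : Tendsto A F (𝓝 A₀)) (h : IsUnit A₀) :
    Tendsto (fun x => (A x)⁻¹) F (𝓝 A₀⁻¹) := by
  have hdet : A₀.det ≠ 0 := ((Matrix.isUnit_iff_isUnit_det A₀).1 h).ne_zero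
  refine (continuousAt_matrix_inv A₀ ?_).tendsto.comp hA
  rw [Ring.inverse_eq_inv']
  exact continuousAt_inv₀ hdet

lemma eventually_isUnit_of_tendsto {α n : Type*} [Fintype n] [DecidableEq n] {F : Filter α}
    {A : α → Matrix n n ℝ} {A₀ : Matrix n n ℝ} (hA : Tendsto A F (𝓝 A₀)) (h : IsUnit A₀) :
    ∀ᶠ x in F, IsUnit (A x) := by
  have hdet : A₀.det ≠ 0 := ((Matrix.isUnit_iff_isUnit_det A₀).1 h).ne_zero
  have hc : Tendsto (fun x => (A x).det) F (𝓝 A₀.det) :=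
    ((continuous_id.matrix_det).tendsto A₀).comp hA
  filter_upwards [hc.eventually_ne hdet] with x hx
  exact (Matrix.isUnit_iff_isUnit_det _).2 (isUnit_iff_ne_zero.2 hx)

lemma tendsto_matrix_mul {α l n o : Type*} [Fintype n] {F : Filter α} {A : α → Matrix l n ℝ}
    {A₀ : Matrix l n ℝ} {B : α → Matrix n o ℝ} {B₀ : Matrix n o ℝ} (hA : Tendsto A F (𝓝 A₀))
    (hB : Tendsto B F (𝓝 B₀)) : Tendsto (fun x => A x * B x) F (𝓝 (A₀ * B₀)) := by
  have hc : Continuous fun C : Matrix l n ℝ × Matrix n o ℝ => C.1 * C.2 := by fun_prop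
  exact (hc.tendsto (A₀, B₀)).comp (hA.prodMk_nhds hB)

lemma tendsto_matrix_transpose {α l n : Type*} {F : Filter α} {A : α → Matrix l n ℝ}
    {A₀ : Matrix l n ℝ} (hA : Tendsto A F (𝓝 A₀)) :
    Tendsto (fun x => (A x)ᵀ) F (𝓝 A₀ᵀ) :=
  ((continuous_id.matrix_transpose).tendsto A₀).comp hA

variable {α E₁ ι κ : Type*} [Fintype ι] [Fintype κ] [NormedAddCommGroup E₁] {F : Filter α}

lemma isBigO_mulVec (A : Matrix κ ι ℝ) (v : α → ι → ℝ) : (fun x => A *ᵥ v x) =O[F] v :=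
  (Matrix.mulVecLin A).toContinuousLinearMap.isBigO_comp v F

lemma isLittleO_mulVec {A : α → Matrix κ ι ℝ} (hA : Tendsto A F (𝓝 0)) {v : α → ι → ℝ}
    {g : α → E₁} (hv : v =O[F] g) : (fun x => A x *ᵥ v x) =o[F] g := by
  rw [isLittleO_pi]
  intro i
  simp only [Matrix.mulVec, dotProduct]
  suffices h : ∀ j ∈ Finset.univ, (fun x => A x i j * v x j) =o[F] g from IsLittleO.fun_sum h
  intro j _
  have h1 : (fun x => A x i j) =o[F] fun _ => (1 : ℝ) := by
    rw [isLittleO_one_iff]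
    exact tendsto_pi_nhds.1 (tendsto_pi_nhds.1 hA i) j
  have h2 : (fun x => v x j) =O[F] g := (isBigO_pi.1 hv) j
  exact isLittleO_norm_right.1 (by simpa only [one_mul] using! h1.mul_isBigO h2.norm_right)

/-- The linearization of restricted estimating equations. Here `A (u - e)` plays the role of the
score, `δ` that of the estimation error and `u` that of the sampling error. -/
lemma isLittleO_projected_score {a r : Type*} [Fintype a] [DecidableEq a] [Fintype r]
    [DecidableEq r] {δ : α → a → ℝ} {u e : α → ι → ℝ} {A : α → Matrix a ι ℝ}
    {A₀ : Matrix a ι ℝ} {M Q : α → Matrix a r ℝ} {M₀ Q₀ : Matrix a r ℝ} {W₀ : Matrix ι a ℝ}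
    {J₀ : Matrix a a ℝ} {H₀ : Matrix r r ℝ}
    (hA : Tendsto A F (𝓝 A₀)) (hM : Tendsto M F (𝓝 M₀)) (hQ : Tendsto Q F (𝓝 Q₀))
    (he : (fun x => e x - W₀ *ᵥ δ x) =o[F] δ) (hδ : (fun x => M₀ᵀ *ᵥ δ x) =o[F] δ)
    (hU : ∀ᶠ x in F, A x *ᵥ (u x - e x) = (M x * (Q x)ᵀ) *ᵥ (A x *ᵥ (u x - e x)))
    (hJ₀ : A₀ * W₀ = J₀) (hJ : IsUnit J₀) (hQJ : Q₀ᵀ * J₀ = H₀ * M₀ᵀ) :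
    (fun x => (Q x)ᵀ *ᵥ (A x *ᵥ (u x - e x)) - (Q₀ᵀ * A₀) *ᵥ u x) =o[F] u := by
  set U : α → a → ℝ := fun x => A x *ᵥ (u x - e x) with hUdef
  -- A common scale for the remainders while `δ` is not yet known to be `O(u)`.
  set g : α → ℝ := fun x => ‖u x‖ + ‖δ x‖ with hg
  have hug : u =O[F] g := IsBigO.of_norm_le fun x => by
    simp only [hg]; linarith [norm_nonneg (δ x)]
  have hδg : δ =O[F] g := IsBigO.of_norm_le fun x => by
    simp only [hg]; linarith [norm_nonneg (u x)]
  have heg : e =O[F] g := by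
    have h1 : e =O[F] δ := by
      have := he.isBigO.add (isBigO_mulVec (F := F) W₀ δ)
      simpa using this
    exact h1.trans hδg
  have hA' : Tendsto (fun x => A x - A₀) F (𝓝 0) := by simpa using hA.sub_const A₀
  have hlin : (fun x => U x - (A₀ *ᵥ u x - J₀ *ᵥ δ x)) =o[F] g := by
    have h1 := isLittleO_mulVec hA' (hug.sub heg)
    have h2 := ((isBigO_mulVec (F := F) A₀ _).trans_isLittleO he).trans_isBigO hδg
    refine (h1.sub h2).congr_left fun x => ?_
    simp only [hUdef, ← hJ₀, ← Matrix.mulVec_mulVec, Matrix.sub_mulVec, Matrix.mulVec_sub]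
    abel
  have hUg : U =O[F] g := by
    have := hlin.isBigO.add (((isBigO_mulVec (F := F) A₀ u).trans hug).sub
      ((isBigO_mulVec (F := F) J₀ δ).trans hδg))
    simpa using this
  have hP : Tendsto (fun x => M x * (Q x)ᵀ - M₀ * Q₀ᵀ) F (𝓝 0) := by
    have hc : Continuous fun B : Matrix a r ℝ × Matrix a r ℝ => B.1 * B.2ᵀ := by fun_prop
    have := ((hc.tendsto (M₀, Q₀)).comp (hM.prodMk_nhds hQ)).sub_const (M₀ * Q₀ᵀ)
    simpa using this
  have hPU : (fun x => U x - (M₀ * Q₀ᵀ) *ᵥ U x) =o[F] g := by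
    refine (isLittleO_mulVec hP hUg).congr' ?_ EventuallyEq.rfl
    filter_upwards [hU] with x hx
    rw [Matrix.sub_mulVec, ← hx]
  have hQδ : (fun x => Q₀ᵀ *ᵥ (J₀ *ᵥ δ x)) =o[F] g := by
    refine (((isBigO_mulVec (F := F) H₀ _).trans_isLittleO hδ).trans_isBigO hδg).congr_left
      fun x => ?_
    rw [Matrix.mulVec_mulVec, Matrix.mulVec_mulVec, hQJ]
  -- Found by solving `U = M₀ Q₀ᵀ U` for `δ`, with `U = A₀ u - J₀ δ` and `Q₀ᵀ J₀ δ` dropped.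
  set B : Matrix a ι ℝ := J₀⁻¹ * (A₀ - M₀ * Q₀ᵀ * A₀) with hB
  have hδu : (fun x => δ x - B *ᵥ u x) =o[F] g := by
    have h1 : (fun x => J₀ *ᵥ δ x - (A₀ - M₀ * Q₀ᵀ * A₀) *ᵥ u x) =o[F] g := by
      have h2 := (isBigO_mulVec (F := F) (M₀ * Q₀ᵀ) _).trans_isLittleO hlin
      have h3 := (isBigO_mulVec (F := F) M₀ _).trans_isLittleO hQδ
      refine (((hPU.sub hlin).add h2).sub h3 |>.neg_left).congr_left fun x => ?_
      simp only [Matrix.sub_mulVec, Matrix.mulVec_sub, ← Matrix.mulVec_mulVec]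
      abel
    refine ((isBigO_mulVec (F := F) J₀⁻¹ _).trans_isLittleO h1).congr_left fun x => ?_
    have hdet := (Matrix.isUnit_iff_isUnit_det J₀).1 hJ
    rw [Matrix.mulVec_sub, Matrix.mulVec_mulVec, Matrix.mulVec_mulVec, Matrix.nonsing_inv_mul _ hdet,
      Matrix.one_mulVec]
  have hδO : δ =O[F] u := by
    obtain ⟨C, hC⟩ := (isBigO_mulVec (F := F) B u).bound
    -- From `‖δ‖ ≤ (‖u‖ + ‖δ‖) / 2 + C ‖u‖`, the term `‖δ‖ / 2` being absorbed on the left.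
    refine IsBigO.of_bound (2 * (1 / 2 + C)) ?_
    filter_upwards [hC, hδu.bound (by norm_num : (0 : ℝ) < 1 / 2)] with x h1 h2
    have h3 : ‖g x‖ = ‖u x‖ + ‖δ x‖ := Real.norm_of_nonneg (by positivity)
    have h4 : ‖δ x‖ ≤ ‖δ x - B *ᵥ u x‖ + ‖B *ᵥ u x‖ := by
      simpa using norm_add_le (δ x - B *ᵥ u x) (B *ᵥ u x)
    rw [h3] at h2
    linarith
  have hgu : g =O[F] u := (isBigO_refl u F).norm_left.add hδO.norm_left
  have hQ' : Tendsto (fun x => (Q x)ᵀ - Q₀ᵀ) F (𝓝 0) := by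
    have hc : Continuous fun B : Matrix a r ℝ => Bᵀ := by fun_prop
    have := ((hc.tendsto Q₀).comp hQ).sub_const Q₀ᵀ
    simpa using this
  have h1 := isLittleO_mulVec hQ' hUg
  have h2 := (isBigO_mulVec (F := F) Q₀ᵀ _).trans_isLittleO hlin
  refine ((h1.add h2).sub hQδ |>.trans_isBigO hgu).congr_left fun x => ?_
  simp only [hUdef, Matrix.sub_mulVec, Matrix.mulVec_sub, ← Matrix.mulVec_mulVec]
  abel

open scoped MatrixOrder in
lemma exists_mul_transpose_eq {n : Type*} [Fintype n] [DecidableEq n] {S : Matrix n n ℝ}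
    (hS : S.PosDef) : ∃ T : Matrix n n ℝ, IsUnit T ∧ T * Tᵀ = S := by
  have hT : (CFC.sqrt S).PosSemidef := Matrix.nonneg_iff_posSemidef.1 (CFC.sqrt_nonneg S)
  have hTT : CFC.sqrt S * CFC.sqrt S = S := CFC.sqrt_mul_sqrt_self S hS.posSemidef.nonneg
  have hsymm : (CFC.sqrt S)ᵀ = CFC.sqrt S := by
    simpa using hT.isHermitian.eq
  refine ⟨CFC.sqrt S, ?_, by rw [hsymm, hTT]⟩
  have := hS.isUnit
  rw [← hTT] at this
  exact (Matrix.isUnit_iff_isUnit_det _).2 (by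
    have := (Matrix.isUnit_iff_isUnit_det _).1 this
    rw [Matrix.det_mul] at this
    exact isUnit_of_mul_isUnit_left this)

end MatrixAnalysis

/-! ### The matrices `J`, `K`, `Q`, `S`: definiteness and continuity. -/

namespace Design

variable {k L r : ℕ} (E : Design k L) {m : (Fin 3 → ℝ) → (Fin r → ℝ)} {β : ℝ} {θ : Fin 3 → ℝ}

lemma W_injective (hJ : IsUnit (E.J β θ)) : Function.Injective (E.W θ).mulVec := by
  intro v w h
  refine (Matrix.mulVec_injective_iff_isUnit.2 hJ) ?_
  change E.W θ *ᵥ v = E.W θ *ᵥ w at h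
  simp only [J, ← Matrix.mulVec_mulVec]
  rw [h]

lemma J_transpose (β : ℝ) (θ : Fin 3 → ℝ) : (E.J β θ)ᵀ = E.J β θ := by
  simp [J, D, Matrix.mul_assoc]

lemma J_posDef (hθ : θ ∈ paramSpace) (hW : Function.Injective (E.W θ).mulVec) :
    (E.J β θ).PosDef := by
  have hD : (E.D θ (β - 1)).PosDef :=
    Matrix.PosDef.diagonal fun j => Real.rpow_pos_of_pos (E.prob_pos hθ j) _
  simpa [J] using hD.conjTranspose_mul_mul_same hW

/-- The multinomial covariance `D_π - π πᵀ`, which conjugated by `D_π^{β-1}` is the inner factor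
of `K_β`. -/
def cov (θ : Fin 3 → ℝ) : Matrix (Fin (L + 1)) (Fin (L + 1)) ℝ :=
  Matrix.diagonal (E.prob θ) - Matrix.vecMulVec (E.prob θ) (E.prob θ)

lemma K_eq (hθ : θ ∈ paramSpace) :
    E.K β θ = (E.W θ)ᵀ * (E.D θ (β - 1) * E.cov θ * E.D θ (β - 1)) * E.W θ := by
  unfold K
  congr 2
  ext i j
  have hi := E.prob_pos hθ i
  have hj := E.prob_pos hθ j
  simp only [cov, D, Matrix.mul_diagonal, Matrix.diagonal_mul, Matrix.sub_apply,
    Matrix.vecMulVec_apply]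
  by_cases h : i = j
  · subst h
    simp only [Matrix.diagonal_apply_eq]
    rw [show 2 * β - 1 = (β - 1) + 1 + (β - 1) by ring, Real.rpow_add hi, Real.rpow_add hi,
      Real.rpow_one, show E.prob θ i ^ β = E.prob θ i ^ (β - 1) * E.prob θ i by
        rw [Real.rpow_sub_one hi.ne']; field_simp]
    ring
  · simp only [Matrix.diagonal_apply_ne _ h]
    rw [Real.rpow_sub_one hi.ne', Real.rpow_sub_one hj.ne']
    field_simp
    ring

/-- Both sides are the variance of `x` under the cell distribution. -/
lemma cov_quadratic (hθ : θ ∈ paramSpace) (x : Fin (L + 1) → ℝ) :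
    x ⬝ᵥ (E.cov θ *ᵥ x) = ∑ j, E.prob θ j * (x j - E.prob θ ⬝ᵥ x) ^ 2 := by
  have h1 : x ⬝ᵥ (E.cov θ *ᵥ x) = ∑ j, E.prob θ j * x j ^ 2 - (E.prob θ ⬝ᵥ x) ^ 2 := by
    rw [cov, Matrix.sub_mulVec, dotProduct_sub, Matrix.vecMulVec_mulVec]
    congr 1
    · simp only [dotProduct, Matrix.mulVec_diagonal]
      exact Finset.sum_congr rfl fun j _ => by ring
    · rw [dotProduct_comm x]
      simp [sq]
  rw [h1]
  generalize hc : E.prob θ ⬝ᵥ x = c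
  have h2 : ∀ j, E.prob θ j * (x j - c) ^ 2 =
      E.prob θ j * x j ^ 2 - 2 * c * (E.prob θ j * x j) + c ^ 2 * E.prob θ j := fun j => by ring
  have h3 : ∑ j, E.prob θ j * x j = c := hc
  simp only [h2, Finset.sum_add_distrib, Finset.sum_sub_distrib, ← Finset.mul_sum, h3,
    E.sum_prob hθ]
  ring

/-- The quadratic form is the variance of `x = D^(β-1) W v`. If it vanishes, `x` is a constant `c`
and `W v` has entries `c π_j^(1-β)`, all of the sign of `c`; they sum to zero, so `c = 0` and `v =
0`. -/
lemma K_posDef (hθ : θ ∈ paramSpace) (hW : Function.Injective (E.W θ).mulVec) :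
    (E.K β θ).PosDef := by
  have hDt : (E.D θ (β - 1))ᵀ = E.D θ (β - 1) := by simp [D]
  have hcovt : (E.cov θ)ᵀ = E.cov θ := by
    ext i j
    by_cases h : i = j
    · simp [h]
    · simp [cov, Matrix.vecMulVec_apply, h, Ne.symm h, mul_comm]
  refine Matrix.PosDef.of_dotProduct_mulVec_pos ?_ fun v hv => ?_
  · rw [Matrix.IsHermitian, Matrix.conjTranspose_eq_transpose_of_trivial, E.K_eq hθ]
    simp only [Matrix.transpose_mul, Matrix.transpose_transpose, hDt, hcovt, Matrix.mul_assoc]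
  set w := E.W θ *ᵥ v with hw
  set x := E.D θ (β - 1) *ᵥ w with hx
  have hform : star v ⬝ᵥ (E.K β θ *ᵥ v) = x ⬝ᵥ (E.cov θ *ᵥ x) := by
    rw [star_trivial, E.K_eq hθ, ← Matrix.mulVec_mulVec, ← Matrix.mulVec_mulVec,
      Matrix.dotProduct_mulVec, Matrix.vecMul_transpose, ← Matrix.mulVec_mulVec,
      ← Matrix.mulVec_mulVec, Matrix.dotProduct_mulVec, ← Matrix.mulVec_transpose, hDt]
  rw [hform, E.cov_quadratic hθ]
  have hxj : ∀ j, x j = E.prob θ j ^ (β - 1) * w j := fun j => by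
    simp [hx, D, Matrix.mulVec_diagonal]
  have hsum : ∑ j, w j = 0 := by
    simp only [hw, Matrix.mulVec, dotProduct]
    rw [Finset.sum_comm]
    simp [← Finset.sum_mul, E.sum_W]
  refine lt_of_le_of_ne (Finset.sum_nonneg fun j _ =>
    mul_nonneg (E.prob_pos hθ j).le (sq_nonneg _)) fun h0 => hv ?_
  have hc : ∀ j, x j = E.prob θ ⬝ᵥ x := fun j => by
    have := (Finset.sum_eq_zero_iff_of_nonneg fun j _ =>
      mul_nonneg (E.prob_pos hθ j).le (sq_nonneg _)).1 h0.symm j (Finset.mem_univ j)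
    have := (mul_eq_zero.1 this).resolve_left (E.prob_pos hθ j).ne'
    exact sub_eq_zero.1 (pow_eq_zero_iff (two_ne_zero)|>.1 this)
  generalize E.prob θ ⬝ᵥ x = c at hc
  have hpow : ∀ j, 0 < E.prob θ j ^ (β - 1) := fun j => Real.rpow_pos_of_pos (E.prob_pos hθ j) _
  have hwj : ∀ j, w j = c * (E.prob θ j ^ (β - 1))⁻¹ := fun j => by
    have := hpow j
    rw [← hc j, hxj j]
    field_simp
  have hc0 : c = 0 := by
    simp only [hwj, ← Finset.mul_sum] at hsum
    refine (mul_eq_zero.1 hsum).resolve_right (ne_of_gt ?_)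
    exact Finset.sum_pos (fun j _ => inv_pos.2 (hpow j)) Finset.univ_nonempty
  refine hW ?_
  change w = _
  ext j
  simp [hwj, hc0]

/-- The matrix `Mᵀ J_β⁻¹ M`. -/
def G (β : ℝ) (m : (Fin 3 → ℝ) → (Fin r → ℝ)) (θ : Fin 3 → ℝ) : Matrix (Fin r) (Fin r) ℝ :=
  (constraintMatrix m θ)ᵀ * (E.J β θ)⁻¹ * constraintMatrix m θ

lemma Q_eq (β : ℝ) (m : (Fin 3 → ℝ) → (Fin r → ℝ)) (θ : Fin 3 → ℝ) :
    E.Q β m θ = (E.J β θ)⁻¹ * constraintMatrix m θ * (E.G β m θ)⁻¹ := rfl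

lemma Q_transpose (β : ℝ) (m : (Fin 3 → ℝ) → (Fin r → ℝ)) (θ : Fin 3 → ℝ) :
    (E.Q β m θ)ᵀ = (E.G β m θ)⁻¹ * ((constraintMatrix m θ)ᵀ * (E.J β θ)⁻¹) := by
  have h : (E.G β m θ)ᵀ = E.G β m θ := by
    simp [G, Matrix.transpose_nonsing_inv, J_transpose, Matrix.mul_assoc]
  rw [Q_eq, Matrix.transpose_mul, Matrix.transpose_mul, Matrix.transpose_nonsing_inv,
    Matrix.transpose_nonsing_inv, h, J_transpose]

lemma Q_transpose_mul (h : IsUnit (E.G β m θ)) :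
    (E.Q β m θ)ᵀ * constraintMatrix m θ = 1 := by
  rw [Q_transpose, Matrix.mul_assoc]
  exact Matrix.nonsing_inv_mul _ ((Matrix.isUnit_iff_isUnit_det _).1 h)

lemma G_posDef (hJ : (E.J β θ).PosDef) (hrank : (constraintMatrix m θ).rank = r) :
    (E.G β m θ).PosDef := by
  simpa [G] using hJ.inv.conjTranspose_mul_mul_same (mulVec_injective_of_rank_eq hrank)

/-- The asymptotic covariance `Qᵀ K Q` of `√N Qᵀ U`. -/
def S (β : ℝ) (m : (Fin 3 → ℝ) → (Fin r → ℝ)) (θ : Fin 3 → ℝ) : Matrix (Fin r) (Fin r) ℝ :=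
  (E.Q β m θ)ᵀ * E.K β θ * E.Q β m θ

/-- `K` is positive definite and `Q` is injective, with left inverse `Mᵀ`. -/
lemma S_posDef (hθ : θ ∈ paramSpace) (hW : Function.Injective (E.W θ).mulVec)
    (hrank : (constraintMatrix m θ).rank = r) : (E.S β m θ).PosDef := by
  have hG := E.G_posDef (E.J_posDef (β := β) hθ hW) hrank
  have hQ : Function.Injective (E.Q β m θ).mulVec := by
    intro v w h
    have h1 : (constraintMatrix m θ)ᵀ * E.Q β m θ = 1 := by
      have := congrArg Matrix.transpose (E.Q_transpose_mul hG.isUnit)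
      simpa using this
    have := congrArg ((constraintMatrix m θ)ᵀ).mulVec h
    simpa [Matrix.mulVec_mulVec, h1] using this
  simpa [S] using (E.K_posDef (β := β) hθ hW).conjTranspose_mul_mul_same hQ



lemma tendsto_W (hθ : θ ∈ paramSpace) : Tendsto E.W (𝓝 θ) (𝓝 (E.W θ)) :=
  E.continuousOn_W.continuousAt (isOpen_paramSpace.mem_nhds hθ)

lemma tendsto_D (hθ : θ ∈ paramSpace) (c : ℝ) : Tendsto (fun θ => E.D θ c) (𝓝 θ) (𝓝 (E.D θ c)) :=
  (E.continuousOn_D c).continuousAt (isOpen_paramSpace.mem_nhds hθ)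

lemma tendsto_J (hθ : θ ∈ paramSpace) (β : ℝ) : Tendsto (E.J β) (𝓝 θ) (𝓝 (E.J β θ)) :=
  tendsto_matrix_mul (tendsto_matrix_mul (tendsto_matrix_transpose (E.tendsto_W hθ))
    (E.tendsto_D hθ (β - 1))) (E.tendsto_W hθ)

lemma tendsto_K (hθ : θ ∈ paramSpace) (β : ℝ) : Tendsto (E.K β) (𝓝 θ) (𝓝 (E.K β θ)) := by
  have h1 : Tendsto (fun θ => fun j => E.prob θ j ^ β) (𝓝 θ) (𝓝 fun j => E.prob θ j ^ β) :=
    tendsto_pi_nhds.2 fun j => (tendsto_pi_nhds.1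
      (E.hasStrictFDerivAt_prob hθ).continuousAt.tendsto j).rpow_const
        (Or.inl (E.prob_pos hθ j).ne')
  have hc : Continuous fun v : Fin (L + 1) → ℝ => Matrix.vecMulVec v v := by fun_prop
  exact tendsto_matrix_mul (tendsto_matrix_mul (tendsto_matrix_transpose (E.tendsto_W hθ))
    ((E.tendsto_D hθ (2 * β - 1)).sub ((hc.tendsto _).comp h1))) (E.tendsto_W hθ)

lemma tendsto_constraintMatrix (hθ : θ ∈ paramSpace)
    (hM : ContinuousOn (constraintMatrix m) paramSpace) :
    Tendsto (constraintMatrix m) (𝓝 θ) (𝓝 (constraintMatrix m θ)) :=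
  hM.continuousAt (isOpen_paramSpace.mem_nhds hθ)

lemma tendsto_G (hθ : θ ∈ paramSpace) (hM : ContinuousOn (constraintMatrix m) paramSpace)
    (hJ : IsUnit (E.J β θ)) : Tendsto (E.G β m) (𝓝 θ) (𝓝 (E.G β m θ)) :=
  tendsto_matrix_mul (tendsto_matrix_mul
    (tendsto_matrix_transpose (tendsto_constraintMatrix hθ hM))
    (tendsto_matrix_inv (E.tendsto_J hθ β) hJ)) (tendsto_constraintMatrix hθ hM)

lemma tendsto_Q (hθ : θ ∈ paramSpace) (hM : ContinuousOn (constraintMatrix m) paramSpace)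
    (hJ : IsUnit (E.J β θ)) (hG : IsUnit (E.G β m θ)) :
    Tendsto (E.Q β m) (𝓝 θ) (𝓝 (E.Q β m θ)) :=
  tendsto_matrix_mul (tendsto_matrix_mul (tendsto_matrix_inv (E.tendsto_J hθ β) hJ)
    (tendsto_constraintMatrix hθ hM)) (tendsto_matrix_inv (E.tendsto_G hθ hM hJ) hG)

lemma tendsto_S (hθ : θ ∈ paramSpace) (hM : ContinuousOn (constraintMatrix m) paramSpace)
    (hJ : IsUnit (E.J β θ)) (hG : IsUnit (E.G β m θ)) :
    Tendsto (E.S β m) (𝓝 θ) (𝓝 (E.S β m θ)) :=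
  tendsto_matrix_mul (tendsto_matrix_mul (tendsto_matrix_transpose (E.tendsto_Q hθ hM hJ hG))
    (E.tendsto_K hθ β)) (E.tendsto_Q hθ hM hJ hG)

/-- The matrix `Qᵀ Wᵀ D_π^{β-1}` by which the sampling error enters `Qᵀ U` to first order. -/
def influence (β : ℝ) (m : (Fin 3 → ℝ) → (Fin r → ℝ)) (θ : Fin 3 → ℝ) :
    Matrix (Fin r) (Fin (L + 1)) ℝ :=
  (E.Q β m θ)ᵀ * ((E.W θ)ᵀ * E.D θ (β - 1))

lemma influence_mul_cov (hθ : θ ∈ paramSpace) :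
    E.influence β m θ * E.cov θ * (E.influence β m θ)ᵀ = E.S β m θ := by
  have hDt : (E.D θ (β - 1))ᵀ = E.D θ (β - 1) := by simp [D]
  rw [S, E.K_eq hθ, influence]
  simp only [Matrix.transpose_mul, Matrix.transpose_transpose, hDt, Matrix.mul_assoc]

/-- The deterministic core: the bound is uniform in `p`, so a random `p̂` and its estimator may be
inserted later. -/
lemma eventually_norm_projected_score_sub_le (hm : ∀ θ ∈ paramSpace, DifferentiableAt ℝ m θ)
    (hM : ContinuousOn (constraintMatrix m) paramSpace) {θ₀ : Fin 3 → ℝ}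
    (hθ₀ : θ₀ ∈ paramSpace) (hJ : IsUnit (E.J β θ₀)) (hG : IsUnit (E.G β m θ₀))
    (hnull : m θ₀ = 0) {ε : ℝ} (hε : 0 < ε) :
    ∀ᶠ θ in 𝓝 θ₀, ∀ p, E.IsRestrictedRoot β m p θ →
      ‖(E.Q β m θ)ᵀ *ᵥ E.U β p θ - E.influence β m θ₀ *ᵥ (p - E.prob θ₀)‖ ≤
        ε * ‖p - E.prob θ₀‖ := by
  -- Only `θ` converges; the factor `⊤` leaves `p` free and yields the uniformity.
  set F : Filter ((Fin 3 → ℝ) × (Fin (L + 1) → ℝ)) :=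
    (𝓝 θ₀ ×ˢ ⊤) ⊓ 𝓟 {x | E.IsRestrictedRoot β m x.2 x.1} with hF
  have hfst : Tendsto Prod.fst F (𝓝 θ₀) := tendsto_fst.mono_left inf_le_left
  have hroot : ∀ᶠ x in F, E.IsRestrictedRoot β m x.2 x.1 :=
    mem_inf_of_right (mem_principal_self _)
  have hA : Tendsto (fun θ => (E.W θ)ᵀ * E.D θ (β - 1)) (𝓝 θ₀)
      (𝓝 ((E.W θ₀)ᵀ * E.D θ₀ (β - 1))) :=
    tendsto_matrix_mul (tendsto_matrix_transpose (E.tendsto_W hθ₀)) (E.tendsto_D hθ₀ (β - 1))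
  have key := isLittleO_projected_score (F := F) (δ := fun x => x.1 - θ₀)
    (u := fun x => x.2 - E.prob θ₀) (e := fun x => E.prob x.1 - E.prob θ₀)
    (A := fun x => (E.W x.1)ᵀ * E.D x.1 (β - 1)) (M := fun x => constraintMatrix m x.1)
    (Q := fun x => E.Q β m x.1) (H₀ := (E.G β m θ₀)⁻¹)
    (hA.comp hfst) ((tendsto_constraintMatrix hθ₀ hM).comp hfst)
    ((E.tendsto_Q hθ₀ hM hJ hG).comp hfst)
    (((E.hasStrictFDerivAt_prob hθ₀).hasFDerivAt.isLittleO.comp_tendsto hfst)) ?_ ?_ rfl hJ ?_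
  · have := key.bound hε
    rw [hF, eventually_inf_principal] at this
    have := this.curry
    filter_upwards [this] with θ hθ p hp
    have := hθ
    rw [eventually_top] at this
    simpa [influence, U] using this p hp
  · refine (((hasStrictFDerivAt_constraint hm hM hθ₀).hasFDerivAt.isLittleO.comp_tendsto
      hfst).neg_left).congr' ?_ EventuallyEq.rfl
    filter_upwards [hroot] with x hx
    simp [hnull, hx.1.2, ← Matrix.sub_vecMul, Matrix.mulVec_transpose]
  · filter_upwards [hroot, hfst.eventually (eventually_isUnit_of_tendsto
      (E.tendsto_G hθ₀ hM hJ) hG)] with x hx hGx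
    obtain ⟨ℓ, hℓ⟩ := hx.2
    have hU : ((E.W x.1)ᵀ * E.D x.1 (β - 1)) *ᵥ (x.2 - E.prob θ₀ - (E.prob x.1 - E.prob θ₀)) =
        constraintMatrix m x.1 *ᵥ (-ℓ) := by
      rw [sub_sub_sub_cancel_right, Matrix.mulVec_neg]
      exact eq_neg_of_add_eq_zero_left hℓ
    rw [hU, Matrix.mulVec_mulVec, Matrix.mul_assoc, E.Q_transpose_mul hGx, Matrix.mul_one]
  · change (E.Q β m θ₀)ᵀ * E.J β θ₀ = _
    rw [Q_transpose, Matrix.mul_assoc, Matrix.mul_assoc,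
      Matrix.nonsing_inv_mul _ ((Matrix.isUnit_iff_isUnit_det _).1 hJ), Matrix.mul_one]

end Design

/-! ### Multinomial frequencies: central limit theorem and tail bounds. -/

section Multinomial

variable {L : ℕ} {q : Fin (L + 1) → ℝ}

lemma isProbabilityMeasure_categorical (hq : ∀ j, 0 ≤ q j) (hsum : ∑ j, q j = 1) :
    IsProbabilityMeasure (categorical q) := by
  constructor
  simp only [categorical, Measure.coe_finsetSum, Finset.sum_apply, Measure.smul_apply,
    measure_univ, smul_eq_mul, mul_one]
  rw [← ENNReal.ofReal_sum_of_nonneg fun j _ => hq j, hsum, ENNReal.ofReal_one]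

lemma integral_categorical (hq : ∀ j, 0 ≤ q j) {V : Type*} [NormedAddCommGroup V]
    [NormedSpace ℝ V] [CompleteSpace V] (f : Fin (L + 1) → V) :
    ∫ c, f c ∂categorical q = ∑ j, q j • f j := by
  rw [categorical, integral_finsetSum_measure]
  · refine Finset.sum_congr rfl fun j _ => ?_
    rw [integral_smul_measure, integral_dirac, ENNReal.toReal_ofReal (hq j)]
  · intro j _
    have : IsFiniteMeasure (ENNReal.ofReal (q j) • Measure.dirac j) :=
      Measure.smul_finite _ ENNReal.ofReal_ne_top
    exact .of_finite

/-- The cell counts of `N` units. -/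
def cellCount {N : ℕ} (c : Fin N → Fin (L + 1)) : Fin (L + 1) → ℕ :=
  fun j => (Finset.univ.filter fun i => c i = j).card

lemma measurable_cellCount {N : ℕ} : Measurable (cellCount (L := L) (N := N)) :=
  .of_discrete

lemma multinomial_eq (N : ℕ) (q : Fin (L + 1) → ℝ) :
    multinomial N q = (Measure.pi fun _ : Fin N => categorical q).map cellCount := rfl

/-- The normalized sampling error `√N (p̂ - q)`. -/
def scaledError (q : Fin (L + 1) → ℝ) (N : ℕ) (n : Fin (L + 1) → ℕ) : Fin (L + 1) → ℝ :=
  √N • (empirical N n - q)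

/-- Summing over units instead of cells exhibits a normalized sum of independent terms. -/
lemma dotProduct_scaledError (w q : Fin (L + 1) → ℝ) {N : ℕ} (c : Fin N → Fin (L + 1)) :
    w ⬝ᵥ scaledError q N (cellCount c) = (√N)⁻¹ * ∑ i, (w (c i) - w ⬝ᵥ q) := by
  obtain rfl | hN := Nat.eq_zero_or_pos N
  · simp [scaledError]
  have hN' : (0 : ℝ) < N := by exact_mod_cast hN
  have h1 : ∑ j, w j * (cellCount c j : ℝ) = ∑ i, w (c i) := by
    simp only [cellCount, Finset.card_filter, Nat.cast_sum, Nat.cast_ite, Nat.cast_one,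
      Nat.cast_zero, Finset.mul_sum]
    rw [Finset.sum_comm]
    simp
  have h2 : w ⬝ᵥ empirical N (cellCount c) = (∑ i, w (c i)) / N := by
    rw [← h1, Finset.sum_div]
    exact Finset.sum_congr rfl fun j _ => by simp [empirical, mul_div_assoc]
  rw [scaledError, dotProduct_smul, dotProduct_sub, h2, Finset.sum_sub_distrib, smul_eq_mul]
  simp only [Finset.sum_const, Finset.card_univ, Fintype.card_fin, nsmul_eq_mul]
  have hs := Real.sqrt_pos.2 hN'
  have hss := Real.mul_self_sqrt hN'.le
  generalize √(N : ℝ) = s at *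
  rw [← hss]
  field_simp

lemma tendsto_integral_exp_scaledError (hq : ∀ j, 0 < q j) (hsum : ∑ j, q j = 1)
    (w : Fin (L + 1) → ℝ) {σ : ℝ} (hσ : 0 ≤ σ)
    (hvar : ∑ j, q j * (w j - w ⬝ᵥ q) ^ 2 = σ ^ 2) :
    Tendsto (fun N : ℕ => ∫ c, Complex.exp ((w ⬝ᵥ scaledError q N c : ℝ) * Complex.I)
      ∂multinomial N q) atTop (𝓝 (Complex.exp (-σ ^ 2 / 2))) := by
  have hprob := isProbabilityMeasure_categorical (fun j => (hq j).le) hsum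
  have hint : ∀ N : ℕ, ∫ c, Complex.exp ((w ⬝ᵥ scaledError q N c : ℝ) * Complex.I)
      ∂multinomial N q = (∫ c, Complex.exp ((((√N)⁻¹ * (w c - w ⬝ᵥ q) : ℝ) : ℂ) * Complex.I)
        ∂categorical q) ^ N := by
    intro N
    rw [multinomial_eq, integral_map measurable_cellCount.aemeasurable
      (Measurable.aestronglyMeasurable (measurable_of_countable _))]
    conv_rhs => rw [← Fintype.card_fin N]
    rw [← integral_fintype_prod_eq_pow]
    congr 1
    ext c
    rw [dotProduct_scaledError, ← Complex.exp_sum, Finset.mul_sum, Complex.ofReal_sum,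
      Finset.sum_mul]
    simp
  simp only [hint]
  -- Standardizing divides by `σ`; when `σ = 0` the summands vanish identically.
  obtain rfl | hσ := hσ.eq_or_lt
  · have hw : ∀ c, w c - w ⬝ᵥ q = 0 := fun c => by
      have := (Finset.sum_eq_zero_iff_of_nonneg fun j _ =>
        mul_nonneg (hq j).le (sq_nonneg _)).1 (hvar.trans (by norm_num)) c (Finset.mem_univ c)
      exact pow_eq_zero_iff two_ne_zero |>.1 ((mul_eq_zero.1 this).resolve_left (hq c).ne')
    simp [hw]
  · have h0 : (categorical q)[fun c => (w c - w ⬝ᵥ q) / σ] = 0 := by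
      rw [integral_categorical fun j => (hq j).le]
      have : ∑ j, q j * (w j - w ⬝ᵥ q) = 0 := by
        simp only [mul_sub, Finset.sum_sub_distrib, ← Finset.sum_mul, hsum, one_mul]
        rw [dotProduct_comm, dotProduct, sub_self]
      simp only [smul_eq_mul, ← mul_div_assoc, ← Finset.sum_div, this, zero_div]
    have h1 : (categorical q)[(fun c => (w c - w ⬝ᵥ q) / σ) ^ 2] = 1 := by
      rw [integral_categorical fun j => (hq j).le]
      simp only [Pi.pow_apply, smul_eq_mul, div_pow, ← mul_div_assoc, ← Finset.sum_div, hvar]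
      exact div_self (by positivity)
    have key := tendsto_charFun_inv_sqrt_mul_pow (P := categorical q)
      (X := fun c => (w c - w ⬝ᵥ q) / σ) (measurable_of_countable _).aemeasurable h0 h1 σ
    refine key.congr fun N => ?_
    congr 1
    rw [charFun_apply_real, integral_map (measurable_of_countable _).aemeasurable
      (by fun_prop)]
    refine integral_congr_ae (ae_of_all _ fun c => ?_)
    simp only
    congr 2
    rw [← Complex.ofReal_mul]
    congr 1
    field_simp

variable {Ω : Type*} [MeasurableSpace Ω] {P : Measure Ω}
  {n : ℕ → Ω → Fin (L + 1) → ℕ}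

/-- The multivariate central limit theorem for linear images of multinomial frequencies with
identity covariance. -/
lemma tendstoInDistribution_mulVec_scaledError [IsProbabilityMeasure P] (hq : ∀ j, 0 < q j)
    (hsum : ∑ j, q j = 1)
    (hn : ∀ N, HasLaw (n N) (multinomial N q) P) {r : ℕ} (C : Matrix (Fin r) (Fin (L + 1)) ℝ)
    (hC : ∀ v : Fin r → ℝ, ∑ j, q j * ((v ᵥ* C) j - (v ᵥ* C) ⬝ᵥ q) ^ 2 = v ⬝ᵥ v) :
    TendstoInDistribution (fun N ω => C *ᵥ scaledError q N (n N ω)) atTop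
      (id : (Fin r → ℝ) → (Fin r → ℝ)) (fun _ => P)
      (Measure.pi fun _ : Fin r => gaussianReal 0 1) := by
  have hlp : TendstoInDistribution
      (fun N ω => WithLp.toLp 2 (C *ᵥ scaledError q N (n N ω))) atTop
      (WithLp.toLp 2 : (Fin r → ℝ) → EuclideanSpace ℝ (Fin r)) (fun _ => P)
      (Measure.pi fun _ : Fin r => gaussianReal 0 1) := by
    have hmeas' : ∀ N, AEMeasurable
        (fun ω => (WithLp.toLp 2 (C *ᵥ scaledError q N (n N ω)) : EuclideanSpace ℝ (Fin r))) P :=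
      fun N => (measurable_of_countable fun c => (WithLp.toLp 2 (C *ᵥ scaledError q N c) :
        EuclideanSpace ℝ (Fin r))).comp_aemeasurable (hn N).aemeasurable
    refine ⟨hmeas', by fun_prop, ?_⟩
    refine ProbabilityMeasure.tendsto_iff_tendsto_charFun.2 fun t => ?_
    simp only [ProbabilityMeasure.coe_mk]
    rw [map_pi_eq_stdGaussian, charFun_stdGaussian]
    have hnorm : ∑ j, q j * ((t.ofLp ᵥ* C) j - (t.ofLp ᵥ* C) ⬝ᵥ q) ^ 2 = ‖t‖ ^ 2 := by
      rw [hC, EuclideanSpace.real_norm_sq_eq]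
      exact Finset.sum_congr rfl fun i _ => by ring
    refine (tendsto_integral_exp_scaledError hq hsum _ (norm_nonneg t) hnorm).congr fun N => ?_
    rw [charFun_apply, integral_map (hmeas' N) (by fun_prop), ← (hn N).map_eq,
      integral_map (hn N).aemeasurable
        (Measurable.aestronglyMeasurable (measurable_of_countable _))]
    refine integral_congr_ae (ae_of_all _ fun ω => ?_)
    simp only
    congr 3
    rw [← Matrix.dotProduct_mulVec, EuclideanSpace.inner_eq_star_dotProduct, star_trivial]
  exact hlp.continuous_comp (g := fun x : EuclideanSpace ℝ (Fin r) => x.ofLp) (by fun_prop)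

/-- Chebyshev's inequality: each coordinate is a sum of `N` independent centred terms of variance at
most `1 / N`. -/
lemma measure_le_abs_scaledError (hq : ∀ j, 0 ≤ q j) (hsum : ∑ j, q j = 1)
    (hn : ∀ N, HasLaw (n N) (multinomial N q) P) (N : ℕ) (j : Fin (L + 1)) {M : ℝ} (hM : 0 < M) :
    P {ω | M ≤ |scaledError q N (n N ω) j|} ≤ ENNReal.ofReal (1 / M ^ 2) := by
  have hprob := isProbabilityMeasure_categorical hq hsum
  rw [(hn N).measure_eq (p := fun c => M ≤ |scaledError q N c j|) (.of_discrete),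
    multinomial_eq, Measure.map_apply measurable_cellCount .of_discrete]
  set f : Fin (L + 1) → ℝ := fun c => (√N)⁻¹ * ((if j = c then 1 else 0) - q j) with hf
  have herr : ∀ c : Fin N → Fin (L + 1),
      scaledError q N (cellCount c) j = (∑ i, fun c : Fin N → Fin (L + 1) => f (c i)) c := by
    intro c
    have := dotProduct_scaledError (Pi.single j 1) q c
    rw [single_one_dotProduct] at this
    rw [this, Finset.sum_apply, Finset.mul_sum]
    simp [hf, Pi.single_apply, eq_comm]
  have hf0 : ∫ c, f c ∂categorical q = 0 := by
    rw [integral_categorical hq]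
    simp only [hf, smul_eq_mul, mul_left_comm _ (√(N : ℝ))⁻¹, ← Finset.mul_sum, mul_sub,
      Finset.sum_sub_distrib, ← Finset.sum_mul, hsum]
    simp
  have hfL : ∀ i : Fin N, MemLp f 2 (categorical q) := fun _ => .of_discrete
  have hmean : ∫ c, (∑ i, fun c : Fin N → Fin (L + 1) => f (c i)) c
      ∂(Measure.pi fun _ : Fin N => categorical q) = 0 := by
    simp only [Finset.sum_apply]
    rw [integral_finsetSum _ fun i _ => .of_finite]
    refine Finset.sum_eq_zero fun i _ => ?_
    rw [integral_comp_eval (μ := fun _ : Fin N => categorical q)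
      (Measurable.aestronglyMeasurable .of_discrete), hf0]
  have hvar : Var[∑ i, fun c : Fin N → Fin (L + 1) => f (c i);
      Measure.pi fun _ : Fin N => categorical q] ≤ 1 := by
    rw [variance_sum_pi hfL, Finset.sum_const, Finset.card_univ, Fintype.card_fin, nsmul_eq_mul]
    obtain rfl | hN := Nat.eq_zero_or_pos N
    · simp
    have hN' : (0 : ℝ) < N := by exact_mod_cast hN
    have h1 : Var[f; categorical q] ≤ 1 / N := by
      rw [variance_of_integral_eq_zero (Measurable.aemeasurable .of_discrete) hf0,
        integral_categorical hq]
      have hle : ∀ c, q c • f c ^ 2 ≤ q c * (1 / N) := fun c => by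
        rw [smul_eq_mul]
        refine mul_le_mul_of_nonneg_left ?_ (hq c)
        have hqj : q j ≤ 1 := hsum ▸ Finset.single_le_sum (fun i _ => hq i) (Finset.mem_univ j)
        have hqj0 := hq j
        have hs : (√(N : ℝ))⁻¹ ^ 2 = 1 / N := by rw [inv_pow, Real.sq_sqrt hN'.le, one_div]
        have hle1 : ((if j = c then 1 else 0 : ℝ) - q j) ^ 2 ≤ 1 := by split_ifs <;> nlinarith
        rw [hf, mul_pow, hs]
        exact mul_le_of_le_one_right (by positivity) hle1
      refine (Finset.sum_le_sum fun c _ => hle c).trans ?_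
      rw [← Finset.sum_mul, hsum, one_mul]
    calc (N : ℝ) * Var[f; categorical q] ≤ N * (1 / N) := by gcongr
      _ = 1 := by field_simp
  have hcheb := meas_ge_le_variance_div_sq (μ := Measure.pi fun _ : Fin N => categorical q)
    (X := ∑ i, fun c : Fin N → Fin (L + 1) => f (c i)) .of_discrete hM
  rw [hmean] at hcheb
  simp only [sub_zero] at hcheb
  simp only [Set.preimage_ofPred_eq, herr]
  exact hcheb.trans (ENNReal.ofReal_le_ofReal (by gcongr))

lemma measure_le_norm_scaledError (hq : ∀ j, 0 ≤ q j) (hsum : ∑ j, q j = 1)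
    (hn : ∀ N, HasLaw (n N) (multinomial N q) P) (N : ℕ) {M : ℝ} (hM : 0 < M) :
    P {ω | M ≤ ‖scaledError q N (n N ω)‖} ≤ ENNReal.ofReal ((L + 1) / M ^ 2) := by
  have hsub : {ω | M ≤ ‖scaledError q N (n N ω)‖} ⊆
      ⋃ j, {ω | M ≤ |scaledError q N (n N ω) j|} := by
    intro ω hω
    by_contra hnot
    simp only [Set.mem_iUnion, Set.mem_ofPred_eq, not_exists, not_le] at hnot hω
    exact absurd hω (not_le.2 ((pi_norm_lt_iff hM).2 hnot))
  calc P {ω | M ≤ ‖scaledError q N (n N ω)‖}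
      ≤ ∑ j, P {ω | M ≤ |scaledError q N (n N ω) j|} :=
        (measure_mono hsub).trans (measure_iUnion_fintype_le _ _)
    _ ≤ ∑ _j : Fin (L + 1), ENNReal.ofReal (1 / M ^ 2) :=
        Finset.sum_le_sum fun j _ => measure_le_abs_scaledError hq hsum hn N j hM
    _ = ENNReal.ofReal ((L + 1) / M ^ 2) := by
        rw [← ENNReal.ofReal_sum_of_nonneg fun _ _ => by positivity]
        simp [div_eq_mul_inv]

lemma tendstoInMeasure_empirical (hq : ∀ j, 0 ≤ q j) (hsum : ∑ j, q j = 1)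
    (hn : ∀ N, HasLaw (n N) (multinomial N q) P) :
    TendstoInMeasure P (fun N ω => empirical N (n N ω)) atTop fun _ => q := by
  rw [tendstoInMeasure_iff_norm]
  intro ε hε
  have hlim : Tendsto (fun N : ℕ => ENNReal.ofReal ((L + 1) / (√N * ε) ^ 2)) atTop (𝓝 0) := by
    rw [← ENNReal.ofReal_zero]
    refine ENNReal.tendsto_ofReal (Tendsto.div_atTop tendsto_const_nhds ?_)
    refine (tendsto_pow_atTop two_ne_zero).comp ?_
    exact (Real.tendsto_sqrt_atTop.comp tendsto_natCast_atTop_atTop).atTop_mul_const hε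
  refine tendsto_of_tendsto_of_tendsto_of_le_of_le' tendsto_const_nhds hlim
    (Eventually.of_forall fun _ => zero_le) ?_
  filter_upwards [eventually_gt_atTop 0] with N hN
  have hs : 0 < √(N : ℝ) := Real.sqrt_pos.2 (by exact_mod_cast hN)
  refine le_trans (measure_mono fun ω hω => ?_)
    (measure_le_norm_scaledError hq hsum hn N (mul_pos hs hε))
  simp only [Set.mem_ofPred_eq, scaledError, norm_smul, Real.norm_of_nonneg hs.le] at hω ⊢
  exact mul_le_mul_of_nonneg_left hω hs.le

end Multinomial

/-! ### Convergence in probability to a constant. -/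

section Convergence

variable {Ω : Type*} [MeasurableSpace Ω] {P : Measure Ω}

lemma tendsto_measure_not_of_tendstoInMeasure {V : Type*} [PseudoMetricSpace V]
    {X : ℕ → Ω → V} {a : V} (hX : TendstoInMeasure P X atTop fun _ => a) {s : V → Prop}
    (hs : ∀ᶠ x in 𝓝 a, s x) : Tendsto (fun N => P {ω | ¬ s (X N ω)}) atTop (𝓝 0) := by
  obtain ⟨δ, hδ, hball⟩ := Metric.eventually_nhds_iff.1 hs
  refine tendsto_of_tendsto_of_tendsto_of_le_of_le tendsto_const_nhds
    (tendstoInMeasure_iff_dist.1 hX δ hδ) (fun _ => zero_le) fun N => measure_mono fun ω hω => ?_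
  by_contra hlt
  exact hω (hball (not_le.1 hlt))

lemma tendstoInMeasure_of_tendsto_nhds {V V' : Type*} [PseudoMetricSpace V]
    [PseudoMetricSpace V'] {X : ℕ → Ω → V} {a : V} {b : V'}
    (hX : TendstoInMeasure P X atTop fun _ => a) {f : V → V'} (hf : Tendsto f (𝓝 a) (𝓝 b)) :
    TendstoInMeasure P (fun N ω => f (X N ω)) atTop fun _ => b := by
  rw [tendstoInMeasure_iff_dist]
  intro ε hε
  have := tendsto_measure_not_of_tendstoInMeasure hX
    (hf.eventually (Metric.ball_mem_nhds b hε))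
  simpa [Metric.mem_ball, not_lt] using this

/-- Every set of counts is measurable, so complements may be taken even for arbitrary estimators. -/
lemma tendsto_measure_not_iff_asymptotically [IsProbabilityMeasure P] {L : ℕ}
    {n : ℕ → Ω → Fin (L + 1) → ℕ} (hn : ∀ N, AEMeasurable (n N) P)
    {s : ℕ → (Fin (L + 1) → ℕ) → Prop} :
    Tendsto (fun N => P {ω | ¬ s N (n N ω)}) atTop (𝓝 0) ↔ Asymptotically P n s := by
  have hnull : ∀ N, NullMeasurableSet {ω | s N (n N ω)} P := fun N =>
    (hn N).nullMeasurableSet_preimage (s := {c | s N c}) .of_discrete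
  have h1 : ∀ N, P {ω | ¬ s N (n N ω)} = 1 - P {ω | s N (n N ω)} := fun N =>
    prob_compl_eq_one_sub₀ (hnull N)
  have h2 : ∀ N, P {ω | s N (n N ω)} = 1 - P {ω | ¬ s N (n N ω)} := fun N => by
    rw [h1, ENNReal.sub_sub_cancel ENNReal.one_ne_top prob_le_one]
  unfold Asymptotically
  constructor
  · intro h
    simp only [h2]
    simpa using ENNReal.Tendsto.sub (tendsto_const_nhds (x := (1 : ENNReal))) h
      (Or.inl ENNReal.one_ne_top)
  · intro h
    simp only [h1]
    simpa using ENNReal.Tendsto.sub (tendsto_const_nhds (x := (1 : ENNReal))) h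
      (Or.inl ENNReal.one_ne_top)

end Convergence

/-! ### Consistent roots and the limit law of the Rao statistic. -/

namespace Design

variable {k L r : ℕ} (E : Design k L) {m : (Fin 3 → ℝ) → (Fin r → ℝ)} {β : ℝ}
  {θ₀ : Fin 3 → ℝ} {Ω : Type*} [MeasurableSpace Ω] {P : Measure Ω} [IsProbabilityMeasure P]
  {n : ℕ → Ω → Fin (L + 1) → ℕ} {est : ℕ → (Fin (L + 1) → ℕ) → (Fin 3 → ℝ)}

lemma exists_consistent_restrictedRoot (hβ : 0 ≤ β)
    (hm : ∀ θ ∈ paramSpace, DifferentiableAt ℝ m θ)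
    (hM : ContinuousOn (constraintMatrix m) paramSpace)
    (hrank : ∀ θ ∈ paramSpace, (constraintMatrix m θ).rank = r) (hθ₀ : θ₀ ∈ paramSpace)
    (hJ : IsUnit (E.J β θ₀)) (hnull : m θ₀ = 0)
    (hn : ∀ N, HasLaw (n N) (multinomial N (E.prob θ₀)) P) :
    ∃ est : ℕ → (Fin (L + 1) → ℕ) → (Fin 3 → ℝ), Consistent P n est θ₀ ∧
      Asymptotically P n fun N c =>
        E.IsRestrictedLocalMinimizer β m (empirical N c) (est N c) ∧
        E.IsRestrictedRoot β m (empirical N c) (est N c) := by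
  have hmc : ContinuousOn m paramSpace := fun θ hθ => (hm θ hθ).continuousAt.continuousWithinAt
  have hemp := tendstoInMeasure_empirical (fun j => (E.prob_pos hθ₀ j).le) (E.sum_prob hθ₀) hn
  obtain ⟨T, hT, hTmin⟩ := E.exists_tendsto_localMinimizer hβ hmc hθ₀ (E.W_injective hJ) hnull
  refine ⟨fun N c => T (empirical N c), tendstoInMeasure_of_tendsto_nhds hemp hT, ?_⟩
  rw [← tendsto_measure_not_iff_asymptotically fun N => (hn N).aemeasurable]
  exact tendsto_measure_not_of_tendstoInMeasure (s := fun p =>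
    E.IsRestrictedLocalMinimizer β m p (T p) ∧ E.IsRestrictedRoot β m p (T p)) hemp
    (hTmin.mono fun p hp => ⟨hp, hp.isRestrictedRoot E hβ hm hM hrank⟩)

lemma tendstoInMeasure_projected_score (hm : ∀ θ ∈ paramSpace, DifferentiableAt ℝ m θ)
    (hM : ContinuousOn (constraintMatrix m) paramSpace) (hθ₀ : θ₀ ∈ paramSpace)
    (hJ : IsUnit (E.J β θ₀)) (hG : IsUnit (E.G β m θ₀)) (hnull : m θ₀ = 0)
    (hn : ∀ N, HasLaw (n N) (multinomial N (E.prob θ₀)) P) (hest : Consistent P n est θ₀)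
    (hroot : Asymptotically P n fun N c => E.IsRestrictedRoot β m (empirical N c) (est N c)) :
    TendstoInMeasure P (fun (N : ℕ) ω => √N • ((E.Q β m (est N (n N ω)))ᵀ *ᵥ
      E.U β (empirical N (n N ω)) (est N (n N ω))) -
        E.influence β m θ₀ *ᵥ scaledError (E.prob θ₀) N (n N ω)) atTop fun _ => 0 := by
  rw [tendstoInMeasure_iff_norm]
  intro η hη
  rw [ENNReal.tendsto_nhds_zero]
  intro κ hκ
  have hκ3 : 0 < κ / 3 := ENNReal.div_pos hκ.ne' (by norm_num)
  -- Chosen so that the tail bound for the scaled error at level `η / ε` costs at most `κ / 3`.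
  obtain ⟨ε, hεκ, hε⟩ : ∃ ε : ℝ, ENNReal.ofReal ((L + 1) * (ε / η) ^ 2) ≤ κ / 3 ∧ 0 < ε := by
    have hc : Continuous fun ε : ℝ => ENNReal.ofReal ((L + 1) * (ε / η) ^ 2) :=
      ENNReal.continuous_ofReal.comp (by fun_prop)
    have h0 : Tendsto (fun ε : ℝ => ENNReal.ofReal ((L + 1) * (ε / η) ^ 2)) (𝓝[>] 0) (𝓝 0) := by
      simpa using (hc.tendsto 0).mono_left nhdsWithin_le_nhds
    exact ((ENNReal.tendsto_nhds_zero.1 h0 _ hκ3).and self_mem_nhdsWithin).exists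
  have hexp := E.eventually_norm_projected_score_sub_le hm hM hθ₀ hJ hG hnull hε
  have h1 := tendsto_measure_not_of_tendstoInMeasure hest hexp
  have h2 := (tendsto_measure_not_iff_asymptotically fun N => (hn N).aemeasurable).2 hroot
  filter_upwards [ENNReal.tendsto_nhds_zero.1 h1 _ hκ3, ENNReal.tendsto_nhds_zero.1 h2 _ hκ3]
    with N hN1 hN2
  have hN3 := (measure_le_norm_scaledError (fun j => (E.prob_pos hθ₀ j).le) (E.sum_prob hθ₀) hn N
    (div_pos hη hε)).trans_eq (by
      rw [show ((L : ℝ) + 1) / (η / ε) ^ 2 = (L + 1) * (ε / η) ^ 2 by field_simp])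
  -- Three bad events: the estimator is too far from `θ₀`, it is not a root, or the scaled error is
  -- large.
  refine (measure_mono (t := ({ω | ¬ ∀ p, E.IsRestrictedRoot β m p (est N (n N ω)) →
    ‖(E.Q β m (est N (n N ω)))ᵀ *ᵥ E.U β p (est N (n N ω)) -
      E.influence β m θ₀ *ᵥ (p - E.prob θ₀)‖ ≤ ε * ‖p - E.prob θ₀‖} ∪
    {ω | ¬ E.IsRestrictedRoot β m (empirical N (n N ω)) (est N (n N ω))}) ∪
    {ω | η / ε ≤ ‖scaledError (E.prob θ₀) N (n N ω)‖}) fun ω hω => ?_).trans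
    ((measure_union_le _ _).trans ((add_le_add ((measure_union_le _ _).trans
      (add_le_add hN1 hN2)) (hN3.trans hεκ)).trans_eq (ENNReal.add_thirds κ)))
  by_contra hnot
  simp only [Set.mem_union, Set.mem_ofPred_eq, not_or, not_not, not_le] at hnot hω
  obtain ⟨⟨hA, hB⟩, hC⟩ := hnot
  have hbd := hA _ hB
  have hs : 0 ≤ √(N : ℝ) := Real.sqrt_nonneg _
  rw [sub_zero, scaledError, Matrix.mulVec_smul, ← smul_sub, norm_smul,
    Real.norm_of_nonneg hs] at hω
  rw [scaledError, norm_smul, Real.norm_of_nonneg hs, lt_div_iff₀ hε] at hC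
  have := mul_le_mul_of_nonneg_left hbd hs
  linarith

/-- A pure change of coordinates, valid for any invertible `T`; it will be used with `T Tᵀ = S(θ₀)`.
-/
lemma rao_eq {T : Matrix (Fin r) (Fin r) ℝ} (hT : IsUnit T) (N : ℕ) (c : Fin (L + 1) → ℕ)
    (θ : Fin 3 → ℝ) :
    E.rao β m N c θ =
      (T⁻¹ *ᵥ (√N • ((E.Q β m θ)ᵀ *ᵥ E.U β (empirical N c) θ))) ⬝ᵥ
        ((Tᵀ * (E.S β m θ)⁻¹ * T) *ᵥ
          (T⁻¹ *ᵥ (√N • ((E.Q β m θ)ᵀ *ᵥ E.U β (empirical N c) θ)))) := by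
  have hTT : T * T⁻¹ = 1 := Matrix.mul_nonsing_inv _ ((Matrix.isUnit_iff_isUnit_det _).1 hT)
  have key : ∀ v : Fin r → ℝ, (T⁻¹ *ᵥ v) ⬝ᵥ ((Tᵀ * (E.S β m θ)⁻¹ * T) *ᵥ (T⁻¹ *ᵥ v)) =
      v ⬝ᵥ ((E.S β m θ)⁻¹ *ᵥ v) := fun v => by
    rw [Matrix.mulVec_mulVec, Matrix.mul_assoc, hTT, Matrix.mul_one, ← Matrix.mulVec_mulVec,
      Matrix.dotProduct_mulVec, Matrix.vecMul_transpose, Matrix.mulVec_mulVec, hTT,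
      Matrix.one_mulVec]
  rw [key, Matrix.mulVec_smul, smul_dotProduct, dotProduct_smul, smul_smul, smul_eq_mul,
    Real.mul_self_sqrt (Nat.cast_nonneg N), rao, ← Matrix.mulVec_mulVec, ← Matrix.mulVec_mulVec,
    Matrix.dotProduct_mulVec, ← Matrix.mulVec_transpose]
  rfl

lemma tendstoInDistribution_rao (hm : ∀ θ ∈ paramSpace, DifferentiableAt ℝ m θ)
    (hM : ContinuousOn (constraintMatrix m) paramSpace)
    (hrank : ∀ θ ∈ paramSpace, (constraintMatrix m θ).rank = r) (hθ₀ : θ₀ ∈ paramSpace)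
    (hJ : IsUnit (E.J β θ₀)) (hnull : m θ₀ = 0)
    (hn : ∀ N, HasLaw (n N) (multinomial N (E.prob θ₀)) P) (hest : Consistent P n est θ₀)
    (hroot : Asymptotically P n fun N c => E.IsRestrictedRoot β m (empirical N c) (est N c)) :
    TendstoInDistribution (fun N ω => E.rao β m N (n N ω) (est N (n N ω))) atTop
      (id : ℝ → ℝ) (fun _ => P) (chiSquare r) := by
  have hW := E.W_injective hJ
  have hG : IsUnit (E.G β m θ₀) := (E.G_posDef (E.J_posDef hθ₀ hW) (hrank θ₀ hθ₀)).isUnit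
  have hS := E.S_posDef (β := β) hθ₀ hW (hrank θ₀ hθ₀)
  obtain ⟨T, hT, hTS⟩ := exists_mul_transpose_eq hS
  have hTdet := (Matrix.isUnit_iff_isUnit_det _).1 hT
  have hTdet' : IsUnit Tᵀ.det := by rwa [Matrix.det_transpose]
  have hTT : T⁻¹ * T = 1 := Matrix.nonsing_inv_mul _ hTdet
  set C : Matrix (Fin r) (Fin (L + 1)) ℝ := T⁻¹ * E.influence β m θ₀ with hC
  have hCcov : C * E.cov θ₀ * Cᵀ = 1 := by
    have h1 : C * E.cov θ₀ * Cᵀ =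
        T⁻¹ * (E.influence β m θ₀ * E.cov θ₀ * (E.influence β m θ₀)ᵀ) * T⁻¹ᵀ := by
      simp only [hC, Matrix.transpose_mul, Matrix.mul_assoc]
    rw [h1, E.influence_mul_cov hθ₀, ← hTS, ← Matrix.mul_assoc, hTT, Matrix.one_mul,
      Matrix.transpose_nonsing_inv, Matrix.mul_nonsing_inv _ hTdet']
  have hclt := tendstoInDistribution_mulVec_scaledError (E.prob_pos hθ₀) (E.sum_prob hθ₀) hn C
    fun v => by
      rw [dotProduct_comm (v ᵥ* C), ← E.cov_quadratic hθ₀, ← Matrix.mulVec_transpose,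
        Matrix.mulVec_mulVec, Matrix.mulVec_transpose, ← Matrix.dotProduct_mulVec,
        Matrix.mulVec_mulVec, ← Matrix.mul_assoc, hCcov, Matrix.one_mulVec]
  have hmeas : ∀ {V : Type} [MeasurableSpace V] (f : ℕ → (Fin (L + 1) → ℕ) → V) (N : ℕ),
      AEMeasurable (fun ω => f N (n N ω)) P := fun f N =>
    (measurable_of_countable (f N)).comp_aemeasurable (hn N).aemeasurable
  have hY : TendstoInDistribution (fun (N : ℕ) ω => T⁻¹ *ᵥ (√N • ((E.Q β m (est N (n N ω)))ᵀ *ᵥ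
      E.U β (empirical N (n N ω)) (est N (n N ω))))) atTop
      (id : (Fin r → ℝ) → (Fin r → ℝ)) (fun _ => P)
      (Measure.pi fun _ : Fin r => gaussianReal 0 1) := by
    -- The limit law passes from the linear term to the whitened score, as their difference is
    -- negligible.
    refine tendstoInDistribution_of_tendstoInMeasure_sub _ _ hclt ?_ (hmeas fun N c =>
      T⁻¹ *ᵥ (√N • ((E.Q β m (est N c))ᵀ *ᵥ E.U β (empirical N c) (est N c))))
    have hc : Continuous fun v : Fin r → ℝ => T⁻¹ *ᵥ v := by fun_prop
    have := tendstoInMeasure_of_tendsto_nhds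
      (E.tendstoInMeasure_projected_score hm hM hθ₀ hJ hG hnull hn hest hroot) (hc.tendsto 0)
    rw [Matrix.mulVec_zero] at this
    convert! this using 1
    funext N ω
    simp only [Pi.sub_apply, hC, Matrix.mulVec_sub, ← Matrix.mulVec_mulVec]
  have hH : TendstoInMeasure P (fun N ω => (fun i j =>
      (Tᵀ * (E.S β m (est N (n N ω)))⁻¹ * T) i j : Fin r → Fin r → ℝ)) atTop
      fun _ => ((1 : Matrix (Fin r) (Fin r) ℝ) : Fin r → Fin r → ℝ) := by
    refine tendstoInMeasure_of_tendsto_nhds hest (f := fun θ => (fun i j =>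
      (Tᵀ * (E.S β m θ)⁻¹ * T) i j : Fin r → Fin r → ℝ)) ?_
    have h1 : Tendsto (fun θ => Tᵀ * (E.S β m θ)⁻¹ * T) (𝓝 θ₀)
        (𝓝 (Tᵀ * (E.S β m θ₀)⁻¹ * T)) :=
      tendsto_matrix_mul (tendsto_matrix_mul tendsto_const_nhds
        (tendsto_matrix_inv (E.tendsto_S hθ₀ hM hJ hG) hS.isUnit)) tendsto_const_nhds
    have h2 : Tᵀ * (E.S β m θ₀)⁻¹ * T = 1 := by
      rw [← hTS, Matrix.mul_inv_rev, ← Matrix.mul_assoc, Matrix.mul_nonsing_inv _ hTdet',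
        Matrix.one_mul, hTT]
    rwa [h2] at h1
  have hg : Continuous fun x : (Fin r → ℝ) × (Fin r → Fin r → ℝ) =>
      x.1 ⬝ᵥ (Matrix.of x.2 *ᵥ x.1) := by
    simp only [dotProduct, Matrix.mulVec, Matrix.of_apply]
    fun_prop
  -- Slutsky's theorem for the quadratic form, whose random matrix tends to the identity.
  have hfin := hY.continuous_comp_prodMk_of_tendstoInMeasure_const hg hH
    (hmeas fun N c => (fun i j => (Tᵀ * (E.S β m (est N c))⁻¹ * T) i j : Fin r → Fin r → ℝ))
  have hlim : (fun v : Fin r → ℝ => (id v) ⬝ᵥ (Matrix.of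
      ((1 : Matrix (Fin r) (Fin r) ℝ) : Fin r → Fin r → ℝ) *ᵥ (id v))) = fun v => ∑ i, v i ^ 2 := by
    funext v
    change v ⬝ᵥ ((1 : Matrix (Fin r) (Fin r) ℝ) *ᵥ v) = _
    rw [Matrix.one_mulVec]
    exact Finset.sum_congr rfl fun i _ => (sq _).symm
  have hrao : (fun N ω => E.rao β m N (n N ω) (est N (n N ω))) = fun (N : ℕ) ω =>
      (T⁻¹ *ᵥ (√N • ((E.Q β m (est N (n N ω)))ᵀ *ᵥ
        E.U β (empirical N (n N ω)) (est N (n N ω))))) ⬝ᵥ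
      (Matrix.of (fun i j => (Tᵀ * (E.S β m (est N (n N ω)))⁻¹ * T) i j) *ᵥ
        (T⁻¹ *ᵥ (√N • ((E.Q β m (est N (n N ω)))ᵀ *ᵥ
          E.U β (empirical N (n N ω)) (est N (n N ω)))))) := by
    funext N ω
    exact E.rao_eq hT N _ _
  rw [hrao]
  refine ⟨hfin.forall_aemeasurable, aemeasurable_id, ?_⟩
  convert! hfin.tendsto using 3
  refine congrArg 𝓝 (Subtype.ext ?_)
  change Measure.map id (chiSquare r) = _
  rw [Measure.map_id, chiSquare, ← hlim]

end Design

end StepStress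

end

theorem theorem3 {k L r : ℕ} (E : StepStress.Design k L) (β : ℝ) (hβ : 0 ≤ β)
    (m : (Fin 3 → ℝ) → (Fin r → ℝ))
    (hm : ∀ θ ∈ StepStress.paramSpace, DifferentiableAt ℝ m θ)
    (hM : ContinuousOn (StepStress.constraintMatrix m) StepStress.paramSpace)
    (hrank : ∀ θ ∈ StepStress.paramSpace, (StepStress.constraintMatrix m θ).rank = r)
    (θ₀ : Fin 3 → ℝ) (hθ₀ : θ₀ ∈ StepStress.paramSpace)
    (hJ : IsUnit (E.J β θ₀))
    (hnull : m θ₀ = 0)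
    {Ω : Type*} [MeasurableSpace Ω] (P : Measure Ω) [IsProbabilityMeasure P]
    (n : ℕ → Ω → Fin (L + 1) → ℕ)
    (hn : ∀ N, HasLaw (n N) (StepStress.multinomial N (E.prob θ₀)) P) :
    (∃ est : ℕ → (Fin (L + 1) → ℕ) → (Fin 3 → ℝ),
      StepStress.Consistent P n est θ₀ ∧
      StepStress.Asymptotically P n fun N c =>
        E.IsRestrictedLocalMinimizer β m (StepStress.empirical N c) (est N c) ∧
        E.IsRestrictedRoot β m (StepStress.empirical N c) (est N c)) ∧
    (∀ est : ℕ → (Fin (L + 1) → ℕ) → (Fin 3 → ℝ),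
      StepStress.Consistent P n est θ₀ →
      (StepStress.Asymptotically P n fun N c =>
        E.IsRestrictedMinimizer β m (StepStress.empirical N c) (est N c) ∨
        E.IsRestrictedRoot β m (StepStress.empirical N c) (est N c)) →
      TendstoInDistribution (fun N ω => E.rao β m N (n N ω) (est N (n N ω))) atTop
        (id : ℝ → ℝ) (fun _ => P) (StepStress.chiSquare r)) := by
  refine ⟨E.exists_consistent_restrictedRoot hβ hm hM hrank hθ₀ hJ hnull hn,
    fun est hest has => E.tendstoInDistribution_rao hm hM hrank hθ₀ hJ hnull hn hest ?_⟩
  -- Minimizers are roots too, so the probability of a root is squeezed between that of the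
  -- hypothesis and one.
  refine tendsto_of_tendsto_of_tendsto_of_le_of_le has tendsto_const_nhds
    (fun N => measure_mono fun ω hω => ?_) fun N => prob_le_one
  exact hω.elim (fun h => (h.isRestrictedLocalMinimizer E).isRestrictedRoot E hβ hm hM hrank) id
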